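/- Let $A$ be a principal ideal domain. For an $A$-module $V$ let $T(V)=\bigoplus_{n\ge 0}V^{\otimes n}$ be the tensor coalgebra, with coproduct $\Delta(c_1|\cdots|c_n)=\sum_{i=0}^n (c_1|\cdots|c_i)\otimes(c_{i+1}|\cdots|c_n)$ and counit the projection to $V^{\otimes 0}=A$. A submodule $H$ of a coalgebra $B$ is a *sub-coalgebra* if $\Delta(H)$ lies in the image of $H\otimes H\to B\otimes B$. For a group $\Gamma$ let $C^*(B\Gamma;A)$ be the dg algebra of normalized simplicial cochains (with cup product) on the simplicial set $B\Gamma\colon[n]\mapsto\Gamma^n$, and let $\overline{C}$ be its augmentation ideal. The Bar construction $Bar(\Gamma;A)$ is $T(\mathbf{s}^{-1}\overline{C})$ with the differential $$d_{Bar}(c_1|\cdots|c_n)=-\sum_{i=1}^{n}\epsilon_{i-1}\, c_1|\cdots|dc_i|\cdots|c_n-\sum_{i=1}^{n-1}\epsilon_i\, c_1|\cdots|c_i\smile c_{i+1}|\cdots|c_n ,\qquad \epsilon_i=\prod_{j\le i}(-1)^{|c_j|-1},$$ where $c_1|\cdots|c_n$ has degree $\sum_i(|c_i|-1)$. Let $H^0_{Bar}(\Gamma;A)$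 be its cohomology in degree $0$; as $Bar(\Gamma;A)$ vanishes in negative degrees, this is the module of cocycles of degree $0$. It is contravariantly functorial in $\Gamma$. For $w\in\Gamma$ and $T\in H^0_{Bar}(\Gamma;A)$, let $L_T(w)\in A[t]$ be the image of $T$ under the map that replaces each cochain $c$ by its value $c([w])$ on the edge $[w]$ of $B\Gamma$ and sends $a_1|\cdots|a_n$ to $a_1\cdots a_n t^n$ (this is the pullback along the simplicial map $S^1\to B\Gamma$ onto $[w]$, followed by $H^0_{Bar}(S^1;A)\cong A[t]$). The *letter-braiding number* $\ell_T(w)\in A$ is the coefficient of $t$ in $L_T(w)$. Let $S$ be a set and $F_S$ the free group on $S$. Restricting cochains to the edges $[s]$, $s\in S$, of $BF_S$ defines a map $H^0_{Bar}(F_S;A)\to T(A^S)$, where $A^S$ is the module of functions $S\to A$. Let $R\subseteq F_S$ be any subset ($S$ and $R$ may be infinite), $\Gamma=\langle S|R\rangle$, and let $p\colon F_S\to\Gamma$ be the quotient map. Then: 1. The map $H^0_{Bar}(F_S;A)\to T(A^S)$ is bijective. Through it, $\ell_T(w)$ is defined for $T\in T(A^S)$ and $w\in F_S$. 2. $H^0_{Bar}(\Gamma;A)$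 has exactly one coalgebra structure for which its inclusion in $T(\mathbf{s}^{-1}\overline{C})$ is a homomorphism of coalgebras. With it, the pullback $p^*\colon H^0_{Bar}(\Gamma;A)\to H^0_{Bar}(F_S;A)\cong T(A^S)$ is an injective homomorphism of coalgebras. 3. The image of $p^*$ is the largest sub-coalgebra $H$ of $T(A^S)$ such that $\ell_T(r)=0$ for all $T\in H$ and all $r\in R$: it is a sub-coalgebra with this property, and it contains every sub-coalgebra with this property. -/

import Mathlib

open scoped TensorProduct DirectSum

noncomputable section

namespace LetterBraiding

/-! ### The tensor coalgebra -/

section TensorCoalgebra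

variable (A : Type*) [CommRing A] (V : Type*) [AddCommGroup V] [Module A V]

/-- The tensor (co)algebra `T(V) = ⨁ₙ V^{⊗ n}`, with the deconcatenation coproduct defined below. -/
def TensorCoalgebra : Type _ := ⨁ n : ℕ, ⨂[A]^n V

instance : AddCommGroup (TensorCoalgebra A V) :=
  inferInstanceAs (AddCommGroup (⨁ n : ℕ, ⨂[A]^n V))

instance : Module A (TensorCoalgebra A V) :=
  inferInstanceAs (Module A (⨁ n : ℕ, ⨂[A]^n V))

namespace TensorCoalgebra

/-- The inclusion of the tensors of weight `n`. -/
def incl (n : ℕ) : (⨂[A]^n V) →ₗ[A] TensorCoalgebra A V :=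
  DirectSum.lof A ℕ (fun n => ⨂[A]^n V) n

variable {A V}

/-- A linear map out of `T(V)` is given by its restriction to each weight. -/
def desc {W : Type*} [AddCommGroup W] [Module A W] (f : ∀ n : ℕ, (⨂[A]^n V) →ₗ[A] W) :
    TensorCoalgebra A V →ₗ[A] W :=
  DirectSum.toModule A ℕ W f

/-- The pure tensor `c₁ | ⋯ | cₙ`. -/
def word {n : ℕ} (c : Fin n → V) : TensorCoalgebra A V :=
  incl A V n (PiTensorProduct.tprod A c)

theorem desc_incl {W : Type*} [AddCommGroup W] [Module A W] (f : ∀ n : ℕ, (⨂[A]^n V) →ₗ[A] W)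
    (n : ℕ) (x : ⨂[A]^n V) : desc f (incl A V n x) = f n x :=
  DirectSum.toModule_lof (M := fun n : ℕ => ⨂[A]^n V) A n x

theorem desc_word {W : Type*} [AddCommGroup W] [Module A W] (f : ∀ n : ℕ, (⨂[A]^n V) →ₗ[A] W)
    {n : ℕ} (c : Fin n → V) : desc f (word c) = f n (PiTensorProduct.tprod A c) :=
  desc_incl f n _

theorem hom_ext {W : Type*} [AddCommGroup W] [Module A W] {f g : TensorCoalgebra A V →ₗ[A] W}
    (h : ∀ (n : ℕ) (c : Fin n → V), f (word c) = g (word c)) : f = g := by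
  refine DirectSum.linearMap_ext A fun n => ?_
  refine PiTensorProduct.ext ?_
  ext c
  exact h n c

theorem word_congr {n m : ℕ} (e : n = m) {c : Fin n → V} {c' : Fin m → V}
    (h : ∀ i, c i = c' (Fin.cast e i)) : (word c : TensorCoalgebra A V) = word c' := by
  subst e
  have : c = c' := funext h
  rw [this]

/-- The part of the coproduct on weight `n` tensors cutting after the first `i` letters. -/
def cut (n : ℕ) (i : Fin (n + 1)) :
    (⨂[A]^n V) →ₗ[A] TensorCoalgebra A V ⊗[A] TensorCoalgebra A V :=
  TensorProduct.map (incl A V i) (incl A V (n - i)) ∘ₗ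
    (TensorPower.mulEquiv (R := A) (M := V) (n := i) (m := n - i)).symm.toLinearMap ∘ₗ
    (TensorPower.cast A V (Nat.add_sub_cancel' (Nat.le_of_lt_succ i.2)).symm).toLinearMap

theorem cut_tprod (n : ℕ) (i : Fin (n + 1)) (c : Fin n → V) :
    cut n i (PiTensorProduct.tprod A c) =
      word (fun j : Fin i => c ⟨j, by omega⟩) ⊗ₜ[A]
        word (fun j : Fin (n - i) => c ⟨i + j, by omega⟩) := by
  have h : n = (i : ℕ) + (n - i) := (Nat.add_sub_cancel' (Nat.le_of_lt_succ i.2)).symm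
  have key : (TensorPower.cast A V h) (PiTensorProduct.tprod A c) =
      TensorPower.mulEquiv (R := A) (M := V) (n := i) (m := n - i)
        ((PiTensorProduct.tprod A fun j : Fin i => c ⟨j, by omega⟩) ⊗ₜ[A]
          (PiTensorProduct.tprod A fun j : Fin (n - i) => c ⟨i + j, by omega⟩)) := by
    rw [TensorPower.cast_tprod]
    refine Eq.trans ?_ (TensorPower.tprod_mul_tprod A _ _).symm
    congr 1
    funext k
    refine Fin.addCases (fun a => ?_) (fun b => ?_) k
    · rw [Fin.append_left]; rfl
    · rw [Fin.append_right]; rfl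
  simp only [cut, LinearMap.comp_apply, LinearEquiv.coe_coe]
  rw [key, LinearEquiv.symm_apply_apply, TensorProduct.map_tmul]
  rfl

/-- Deconcatenation `Δ(c₁|⋯|cₙ) = ∑ᵢ (c₁|⋯|cᵢ) ⊗ (cᵢ₊₁|⋯|cₙ)`. -/
def deconcat : TensorCoalgebra A V →ₗ[A] TensorCoalgebra A V ⊗[A] TensorCoalgebra A V :=
  desc fun n => ∑ i : Fin (n + 1), cut n i

/-- The counit: projection to the weight zero part `A`. -/
def wtZero : TensorCoalgebra A V →ₗ[A] A :=
  desc fun n => match n with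
    | 0 => (PiTensorProduct.isEmptyEquiv (R := A) (s := fun _ => V) (Fin 0)).toLinearMap
    | _ + 1 => 0

theorem wtZero_word {n : ℕ} (c : Fin n → V) :
    wtZero (word c : TensorCoalgebra A V) = if n = 0 then 1 else 0 := by
  rw [wtZero, desc_word]
  cases n with
  | zero => simp
  | succ n => simp

/-- The pure tensor with the letters of a list. -/
def listWord (l : List V) : TensorCoalgebra A V := word l.get

theorem word_eq_listWord {n : ℕ} (c : Fin n → V) :
    (word c : TensorCoalgebra A V) = listWord (List.ofFn c) :=
  word_congr (by simp) (by simp)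

theorem deconcat_listWord (l : List V) :
    deconcat (listWord l : TensorCoalgebra A V) =
      ∑ i ∈ Finset.range (l.length + 1), listWord (l.take i) ⊗ₜ[A] listWord (l.drop i) := by
  rw [deconcat, listWord, desc_word, LinearMap.sum_apply, Finset.sum_range]
  refine Finset.sum_congr rfl fun i _ => ?_
  rw [cut_tprod]
  have hi : (i : ℕ) ≤ l.length := Nat.le_of_lt_succ i.2
  congr 1
  · exact word_congr (by simp [hi]) (by simp)
  · exact word_congr (by simp) (by simp)

theorem wtZero_listWord (l : List V) :
    wtZero (listWord l : TensorCoalgebra A V) = if l.length = 0 then 1 else 0 :=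
  wtZero_word _

theorem listHom_ext {W : Type*} [AddCommGroup W] [Module A W] {f g : TensorCoalgebra A V →ₗ[A] W}
    (h : ∀ l : List V, f (listWord l) = g (listWord l)) : f = g :=
  hom_ext fun n c => by rw [word_eq_listWord]; exact h _

instance : Coalgebra A (TensorCoalgebra A V) where
  comul := deconcat
  counit := wtZero
  coassoc := by
    refine listHom_ext fun l => ?_
    simp only [LinearMap.comp_apply, deconcat_listWord, map_sum, LinearMap.rTensor_tmul,
      LinearMap.lTensor_tmul, TensorProduct.sum_tmul, TensorProduct.tmul_sum,
      LinearEquiv.coe_coe, TensorProduct.assoc_tmul]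
    rw [Finset.sum_sigma', Finset.sum_sigma']
    refine Finset.sum_bij' (fun x _ => ⟨x.2, x.1 - x.2⟩) (fun x _ => ⟨x.1 + x.2, x.1⟩) ?_ ?_ ?_ ?_ ?_
    · rintro ⟨i, j⟩ h
      simp only [Finset.mem_sigma, Finset.mem_range, List.length_take, List.length_drop] at h ⊢
      omega
    · rintro ⟨i, j⟩ h
      simp only [Finset.mem_sigma, Finset.mem_range, List.length_take, List.length_drop] at h ⊢
      omega
    · rintro ⟨i, j⟩ h
      simp only [Finset.mem_sigma, Finset.mem_range, List.length_take] at h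
      have : j + (i - j) = i := by omega
      simp [this]
    · rintro ⟨i, j⟩ h
      simp
    · rintro ⟨i, j⟩ h
      simp only [Finset.mem_sigma, Finset.mem_range, List.length_take] at h
      have h1 : min j i = j := by omega
      have h2 : j + (i - j) = i := by omega
      simp only [List.take_take, List.drop_drop, h1, h2, List.drop_take]
  rTensor_counit_comp_comul := by
    refine listHom_ext fun l => ?_
    simp only [LinearMap.comp_apply, deconcat_listWord, map_sum, LinearMap.rTensor_tmul,
      wtZero_listWord, TensorProduct.mk_apply]
    rw [Finset.sum_eq_single 0]
    · simp
    · intro i hi hi0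
      rw [Finset.mem_range] at hi
      have : (l.take i).length ≠ 0 := by rw [List.length_take]; omega
      rw [if_neg this, TensorProduct.zero_tmul]
    · simp
  lTensor_counit_comp_comul := by
    refine listHom_ext fun l => ?_
    simp only [LinearMap.comp_apply, deconcat_listWord, map_sum, LinearMap.lTensor_tmul,
      wtZero_listWord, LinearMap.flip_apply, TensorProduct.mk_apply]
    rw [Finset.sum_eq_single l.length]
    · simp
    · intro i hi hi0
      rw [Finset.mem_range] at hi
      have : (l.drop i).length ≠ 0 := by rw [List.length_drop]; omega
      rw [if_neg this, TensorProduct.tmul_zero]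
    · simp

/-- The map `T(f) : T(V) → T(W)` induced by a linear map `f : V → W`. -/
def map {W : Type*} [AddCommGroup W] [Module A W] (f : V →ₗ[A] W) :
    TensorCoalgebra A V →ₗ[A] TensorCoalgebra A W :=
  desc fun n => incl A W n ∘ₗ PiTensorProduct.map fun _ => f

theorem map_word {W : Type*} [AddCommGroup W] [Module A W] (f : V →ₗ[A] W) {n : ℕ}
    (c : Fin n → V) : map f (word c : TensorCoalgebra A V) = word fun i => f (c i) := by
  rw [map, desc_word, LinearMap.comp_apply, PiTensorProduct.map_tprod]
  rfl

end TensorCoalgebra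

end TensorCoalgebra

/-! ### The Bar differential -/

section BarDifferential

variable {A : Type*} [CommRing A] {V : Type*} [AddCommGroup V] [Module A V]

theorem contractNth_update {n : ℕ} (μ : V →ₗ[A] V →ₗ[A] V) (i : Fin n) (c : Fin (n + 1) → V)
    (m : Fin (n + 1)) : ∃ g : V →ₗ[A] V, ∀ x : V,
      Fin.contractNth i.castSucc (fun a b => μ a b) (Function.update c m x) =
        Function.update (Fin.contractNth i.castSucc (fun a b => μ a b) c) (i.predAbove m) (g x) := by
  rcases lt_trichotomy (m : ℕ) i with hm | hm | hm
  · refine ⟨LinearMap.id, fun x => ?_⟩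
    have hp : ((i.predAbove m : Fin n) : ℕ) = m := by
      rw [Fin.predAbove_of_le_castSucc _ _ (by rw [Fin.le_def]; simp; omega)]; rfl
    funext k
    by_cases hk : k = i.predAbove m
    · subst hk
      have h1 : (i.predAbove m).castSucc = m := Fin.ext (by simpa using hp)
      simp [Fin.contractNth, hp, hm, h1]
    · have hk' : (k : ℕ) ≠ m := fun h => hk (Fin.ext (by omega))
      have h1 : k.castSucc ≠ m := fun h => hk' (by rw [← h]; rfl)
      rw [Function.update_of_ne hk]
      simp only [Fin.contractNth, Fin.val_castSucc]
      split_ifs with h2 h3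
      · rw [Function.update_of_ne h1]
      · have h4 : k.succ ≠ m := fun h => by rw [← h] at hm; simp at hm; omega
        rw [Function.update_of_ne h1, Function.update_of_ne h4]
      · have h4 : k.succ ≠ m := fun h => by rw [← h] at hm; simp at hm; omega
        rw [Function.update_of_ne h4]
  · refine ⟨μ.flip (c i.succ), fun x => ?_⟩
    have hm' : m = i.castSucc := Fin.ext hm
    subst hm'
    rw [Fin.predAbove_castSucc_self]
    funext k
    by_cases hk : k = i
    · subst hk
      simp [Fin.contractNth, (Fin.castSucc_lt_succ (i := k)).ne']
    · have hk' : (k : ℕ) ≠ i := fun h => hk (Fin.ext h)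
      rw [Function.update_of_ne hk]
      simp only [Fin.contractNth, Fin.val_castSucc, if_neg hk']
      split_ifs with h2
      · rw [Function.update_of_ne (fun h => hk (Fin.castSucc_injective _ h))]
      · rw [Function.update_of_ne (fun h => by
          have := congrArg Fin.val h; simp at this; omega)]
  · by_cases hm1 : (m : ℕ) = i + 1
    · refine ⟨μ (c i.castSucc), fun x => ?_⟩
      have hm' : m = i.succ := Fin.ext (by simpa using hm1)
      subst hm'
      rw [Fin.predAbove_succ_self]
      funext k
      by_cases hk : k = i
      · subst hk
        simp [Fin.contractNth, (Fin.castSucc_lt_succ (i := k)).ne]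
      · have hk' : (k : ℕ) ≠ i := fun h => hk (Fin.ext h)
        rw [Function.update_of_ne hk]
        simp only [Fin.contractNth, Fin.val_castSucc, if_neg hk']
        split_ifs with h2
        · rw [Function.update_of_ne (fun h => by
            have := congrArg Fin.val h; simp at this; omega)]
        · rw [Function.update_of_ne (fun h => hk (Fin.succ_injective _ h))]
    · refine ⟨LinearMap.id, fun x => ?_⟩
      have hp : ((i.predAbove m : Fin n) : ℕ) = m - 1 := by
        rw [Fin.predAbove_of_castSucc_lt _ _ (by rw [Fin.lt_def]; simpa using hm)]; rfl
      funext k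
      by_cases hk : k = i.predAbove m
      · subst hk
        have h1 : (i.predAbove m).succ = m := Fin.ext (by simp [hp]; omega)
        have h2 : ¬ (m : ℕ) - 1 < i := by omega
        have h3 : ¬ (m : ℕ) - 1 = i := by omega
        simp [Fin.contractNth, hp, h1, h2, h3]
      · have hk' : (k : ℕ) ≠ m - 1 := fun h => hk (Fin.ext (by omega))
        have h1 : k.succ ≠ m := fun h => hk' (by rw [← h]; simp)
        rw [Function.update_of_ne hk]
        simp only [Fin.contractNth, Fin.val_castSucc]
        split_ifs with h2 h3
        · rw [Function.update_of_ne (fun h => by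
            have := congrArg Fin.val h; simp at this; omega)]
        · rw [Function.update_of_ne h1, Function.update_of_ne (fun h => by
            have := congrArg Fin.val h; simp at this; omega)]
        · rw [Function.update_of_ne h1]

/-- Multiplication of two consecutive factors,
`c₀ ⊗ ⋯ ⊗ cₙ ↦ c₀ ⊗ ⋯ ⊗ μ(cᵢ, cᵢ₊₁) ⊗ ⋯ ⊗ cₙ`. -/
def mulAt (μ : V →ₗ[A] V →ₗ[A] V) {n : ℕ} (i : Fin n) : (⨂[A]^(n + 1) V) →ₗ[A] ⨂[A]^n V :=
  PiTensorProduct.lift (MultilinearMap.mk'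
    (fun c : Fin (n + 1) → V =>
      PiTensorProduct.tprod A (Fin.contractNth i.castSucc (fun a b => μ a b) c))
    (by
      intro c m x y
      obtain ⟨g, hg⟩ := contractNth_update μ i c m
      simp only [hg, map_add, MultilinearMap.map_update_add])
    (by
      intro c m a x
      obtain ⟨g, hg⟩ := contractNth_update μ i c m
      simp only [hg, map_smul, MultilinearMap.map_update_smul]))

theorem mulAt_tprod (μ : V →ₗ[A] V →ₗ[A] V) {n : ℕ} (i : Fin n) (c : Fin (n + 1) → V) :
    mulAt μ i (PiTensorProduct.tprod A c) =
      PiTensorProduct.tprod A (Fin.contractNth i.castSucc (fun a b => μ a b) c) :=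
  PiTensorProduct.lift.tprod _

/-- The internal part of the Bar differential on weight `n` tensors:
`d₁(c₁|⋯|cₙ) = -∑ᵢ ± c₁|⋯|d cᵢ|⋯|cₙ` with sign `∏_{j < i} (-1)^{|cⱼ| - 1}`. Here `s` is the operator
`c ↦ (-1)^{|c| - 1} c`. -/
def barInternal (s d : V →ₗ[A] V) (n : ℕ) : (⨂[A]^n V) →ₗ[A] ⨂[A]^n V :=
  -∑ i : Fin n, PiTensorProduct.map fun j : Fin n =>
    if j < i then s else if j = i then d else LinearMap.id

theorem barInternal_tprod (s d : V →ₗ[A] V) (n : ℕ) (c : Fin n → V) :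
    barInternal s d n (PiTensorProduct.tprod A c) =
      -∑ i : Fin n, PiTensorProduct.tprod A fun j : Fin n =>
        (if j < i then s else if j = i then d else LinearMap.id) (c j) := by
  simp only [barInternal]
  refine (LinearMap.neg_apply _ _).trans ?_
  rw [LinearMap.sum_apply]
  congr 1
  exact Finset.sum_congr rfl fun i _ => PiTensorProduct.map_tprod _ _

/-- The external part of the Bar differential on weight `n + 1` tensors:
`d₂(c₀|⋯|cₙ) = -∑ᵢ ± c₀|⋯|μ(cᵢ, cᵢ₊₁)|⋯|cₙ` with sign `∏_{j ≤ i} (-1)^{|cⱼ| - 1}`. -/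
def barExternal (s : V →ₗ[A] V) (μ : V →ₗ[A] V →ₗ[A] V) (n : ℕ) :
    (⨂[A]^(n + 1) V) →ₗ[A] ⨂[A]^n V :=
  -∑ i : Fin n, mulAt μ i ∘ₗ PiTensorProduct.map fun j : Fin (n + 1) =>
    if j ≤ i.castSucc then s else LinearMap.id

theorem barExternal_tprod (s : V →ₗ[A] V) (μ : V →ₗ[A] V →ₗ[A] V) (n : ℕ) (c : Fin (n + 1) → V) :
    barExternal s μ n (PiTensorProduct.tprod A c) =
      -∑ i : Fin n, PiTensorProduct.tprod A (Fin.contractNth i.castSucc (fun a b => μ a b)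
        fun j => (if j ≤ i.castSucc then s else LinearMap.id) (c j)) := by
  simp only [barExternal]
  refine (LinearMap.neg_apply _ _).trans ?_
  rw [LinearMap.sum_apply]
  congr 1
  refine Finset.sum_congr rfl fun i _ => ?_
  rw [LinearMap.comp_apply, ← mulAt_tprod]
  congr 1
  exact PiTensorProduct.map_tprod _ _

/-- The total Bar differential `d₁ + d₂` on `T(V)`, where `V` is (the desuspension of) the
augmentation ideal of a dg algebra with differential `d`, product `μ` and
sign operator `s c = (-1)^{|c| - 1} c`. -/
def barDifferential (s d : V →ₗ[A] V) (μ : V →ₗ[A] V →ₗ[A] V) :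
    TensorCoalgebra A V →ₗ[A] TensorCoalgebra A V :=
  TensorCoalgebra.desc fun n => match n with
    | 0 => 0
    | n + 1 => TensorCoalgebra.incl A V (n + 1) ∘ₗ barInternal s d (n + 1) +
        TensorCoalgebra.incl A V n ∘ₗ barExternal s μ n

theorem barDifferential_word_zero (s d : V →ₗ[A] V) (μ : V →ₗ[A] V →ₗ[A] V) (c : Fin 0 → V) :
    barDifferential s d μ (TensorCoalgebra.word c) = 0 := by
  rw [barDifferential, TensorCoalgebra.desc_word]
  rfl

theorem barDifferential_word (s d : V →ₗ[A] V) (μ : V →ₗ[A] V →ₗ[A] V) (n : ℕ)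
    (c : Fin (n + 1) → V) :
    barDifferential s d μ (TensorCoalgebra.word c) =
      -∑ i : Fin (n + 1), TensorCoalgebra.word (fun j : Fin (n + 1) =>
        (if j < i then s else if j = i then d else LinearMap.id) (c j)) +
      -∑ i : Fin n, TensorCoalgebra.word (Fin.contractNth i.castSucc (fun a b => μ a b)
        fun j => (if j ≤ i.castSucc then s else LinearMap.id) (c j)) := by
  rw [barDifferential, TensorCoalgebra.desc_word]
  simp only [LinearMap.add_apply, LinearMap.comp_apply]
  rw [barInternal_tprod, barExternal_tprod, map_neg, map_neg, map_sum, map_sum]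
  rfl

/-- The part of degree `k` of the Bar construction: spanned by the tensors `c₁|⋯|cₙ` of homogeneous
elements with `∑ᵢ (|cᵢ| - 1) = k`. Here `hom p` is the submodule of elements of degree `p`. -/
def barDegree (hom : ℕ → Submodule A V) (k : ℤ) : Submodule A (TensorCoalgebra A V) :=
  Submodule.span A {T | ∃ (n : ℕ) (p : Fin n → ℕ) (c : Fin n → V),
    (∀ i, c i ∈ hom (p i)) ∧ ∑ i, ((p i : ℤ) - 1) = k ∧ T = TensorCoalgebra.word c}

end BarDifferential

/-! ### Cochains on the classifying space of a group -/

section Cochains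

variable (A : Type*) [CommRing A] (Γ : Type*) [Group Γ]

/-- The simplices (of all dimensions) of the simplicial set `BΓ : [n] ↦ Γⁿ`. -/
abbrev Simplex : Type _ := Σ n : ℕ, (Fin n → Γ)

variable {Γ}

/-- The faces of `BΓ`: the extremal faces forget the first, resp. last, coordinate, and the inner
faces multiply adjacent coordinates (`Fin.contractNth` at the last index forgets the last entry). -/
def face {n : ℕ} (i : Fin (n + 2)) (g : Fin (n + 1) → Γ) : Fin n → Γ :=
  Fin.cases (Fin.tail g) (fun j => Fin.contractNth j (· * ·) g) i

variable (Γ)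

/-- The simplicial coboundary `(df)(σ) = ∑ᵢ (-1)ⁱ f(∂ᵢ σ)`. -/
def coboundary : (Simplex Γ → A) →ₗ[A] (Simplex Γ → A) where
  toFun f σ := match σ with
    | ⟨0, _⟩ => 0
    | ⟨n + 1, g⟩ => ∑ i : Fin (n + 2), (-1) ^ (i : ℕ) * f ⟨n, face i g⟩
  map_add' f f' := by
    funext σ
    rcases σ with ⟨_ | n, g⟩
    · simp
    · simp [mul_add, Finset.sum_add_distrib]
  map_smul' a f := by
    funext σ
    rcases σ with ⟨_ | n, g⟩
    · simp
    · simp [Finset.mul_sum, mul_left_comm]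

/-- The front `i`-face `(g₁, …, gᵢ)` of an `n`-simplex. -/
def front {Γ : Type*} {n : ℕ} (i : Fin (n + 1)) (g : Fin n → Γ) : Simplex Γ :=
  ⟨i, fun j => g ⟨j, by omega⟩⟩

/-- The back `(n - i)`-face `(gᵢ₊₁, …, gₙ)` of an `n`-simplex. -/
def back {Γ : Type*} {n : ℕ} (i : Fin (n + 1)) (g : Fin n → Γ) : Simplex Γ :=
  ⟨n - i, fun j => g ⟨i + j, by omega⟩⟩

/-- The cup product `(f ⌣ f')(σ) = ∑ f(front σ) f'(back σ)`; on cochains homogeneous of degrees `p`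
and `q` only the front `p`-face and the back `q`-face of `(p + q)`-simplices contribute. -/
def cup : (Simplex Γ → A) →ₗ[A] (Simplex Γ → A) →ₗ[A] (Simplex Γ → A) :=
  LinearMap.mk₂ A
    (fun f f' σ => ∑ i : Fin (σ.1 + 1), f (front i σ.2) * f' (back i σ.2))
    (fun f f' h => by funext σ; simp [add_mul, Finset.sum_add_distrib])
    (fun a f h => by funext σ; simp [Finset.mul_sum, mul_assoc])
    (fun f h h' => by funext σ; simp [mul_add, Finset.sum_add_distrib])
    (fun a f h => by funext σ; simp [Finset.mul_sum, mul_left_comm])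

/-- The normalized simplicial cochains `C^*(BΓ;A) = ⨁ₙ Cⁿ(BΓ;A)`, as functions on all simplices:
they vanish on degenerate simplices (those with a coordinate `1`) and in all large dimensions. -/
def cochains : Submodule A (Simplex Γ → A) where
  carrier := {f | (∀ (n : ℕ) (g : Fin n → Γ), (∃ i, g i = 1) → f ⟨n, g⟩ = 0) ∧
    ∃ N : ℕ, ∀ (n : ℕ) (g : Fin n → Γ), N < n → f ⟨n, g⟩ = 0}
  zero_mem' := ⟨fun _ _ _ => rfl, 0, fun _ _ _ => rfl⟩
  add_mem' := by
    rintro f f' ⟨h, N, hN⟩ ⟨h', N', hN'⟩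
    refine ⟨fun n g hg => by simp [h n g hg, h' n g hg], max N N', fun n g hn => ?_⟩
    simp [hN n g (lt_of_le_of_lt (le_max_left _ _) hn),
      hN' n g (lt_of_le_of_lt (le_max_right _ _) hn)]
  smul_mem' := by
    rintro a f ⟨h, N, hN⟩
    exact ⟨fun n g hg => by simp [h n g hg], N, fun n g hn => by simp [hN n g hn]⟩

/-- The augmentation: evaluation at the base point, the unique vertex of `BΓ`. -/
def augmentation : (Simplex Γ → A) →ₗ[A] A := LinearMap.proj ⟨0, Fin.elim0⟩

/-- The augmentation ideal of `C^*(BΓ;A)`. -/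
def augIdeal : Submodule A (Simplex Γ → A) :=
  cochains A Γ ⊓ LinearMap.ker (augmentation A Γ)

variable {A Γ}

theorem augIdeal_zero {f : Simplex Γ → A} (hf : f ∈ augIdeal A Γ) (g : Fin 0 → Γ) :
    f ⟨0, g⟩ = 0 := by
  have : g = Fin.elim0 := Subsingleton.elim _ _
  subst this
  exact hf.2

theorem face_eq_of_one {n : ℕ} (g : Fin (n + 1) → Γ) (k : Fin (n + 1)) (hk : g k = 1) :
    face k.castSucc g = face k.succ g := by
  funext m
  cases k using Fin.cases with
  | zero =>
    simp only [face, Fin.castSucc_zero, Fin.cases_zero, Fin.cases_succ, Fin.tail, Fin.contractNth]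
    split_ifs with h1 h2
    · simp at h1
    · have : m.castSucc = 0 := Fin.ext (by simpa using h2)
      rw [this, hk, one_mul]
    · rfl
  | succ k =>
    rw [← Fin.succ_castSucc]
    simp only [face, Fin.cases_succ, Fin.contractNth, Fin.val_castSucc, Fin.val_succ]
    rcases lt_trichotomy (m : ℕ) k with h | h | h
    · rw [if_pos h, if_pos (by omega)]
    · have hm : m = k := Fin.ext h
      subst hm
      rw [if_neg (by omega), if_pos rfl, if_pos (by omega), hk, mul_one]
    · rw [if_neg (by omega), if_neg (by omega), if_neg (by omega)]
      by_cases h3 : (m : ℕ) = k + 1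
      · rw [if_pos h3]
        have : m.castSucc = k.succ := Fin.ext (by simpa using h3)
        rw [this, hk, one_mul]
      · rw [if_neg h3]

theorem face_has_one {n : ℕ} (g : Fin (n + 1) → Γ) (k : Fin (n + 1)) (hk : g k = 1)
    (i : Fin (n + 2)) (h1 : i ≠ k.castSucc) (h2 : i ≠ k.succ) : ∃ m, face i g m = 1 := by
  have h1' : (i : ℕ) ≠ k := fun h => h1 (Fin.ext h)
  have h2' : (i : ℕ) ≠ k + 1 := fun h => h2 (Fin.ext (by simpa using h))
  cases i using Fin.cases with
  | zero =>
    have hk0 : (k : ℕ) ≠ 0 := fun h => h1' (by simp [h])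
    refine ⟨⟨k - 1, by omega⟩, ?_⟩
    have : (⟨(k : ℕ) - 1, by omega⟩ : Fin n).succ = k := Fin.ext (by simp; omega)
    simp only [face, Fin.cases_zero, Fin.tail]
    rw [this, hk]
  | succ j =>
    simp only [Fin.val_succ] at h1' h2'
    simp only [face, Fin.cases_succ]
    by_cases hlt : (k : ℕ) < j
    · refine ⟨⟨k, by omega⟩, ?_⟩
      rw [Fin.contractNth_apply_of_lt _ _ _ _ hlt]
      exact hk
    · refine ⟨⟨k - 1, by omega⟩, ?_⟩
      rw [Fin.contractNth_apply_of_gt _ _ _ _ (by simp; omega)]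
      have : (⟨(k : ℕ) - 1, by omega⟩ : Fin n).succ = k := Fin.ext (by simp; omega)
      rw [this, hk]

theorem coboundary_mem {f : Simplex Γ → A} (hf : f ∈ augIdeal A Γ) :
    coboundary A Γ f ∈ augIdeal A Γ := by
  refine ⟨⟨?_, ?_⟩, rfl⟩
  · rintro (_ | n) g ⟨k, hk⟩
    · exact k.elim0
    · change ∑ i : Fin (n + 2), (-1) ^ (i : ℕ) * f ⟨n, face i g⟩ = 0
      rw [Fintype.sum_eq_add k.castSucc k.succ (Fin.castSucc_lt_succ).ne]
      · rw [face_eq_of_one g k hk]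
        simp [pow_succ]
      · rintro i ⟨h1, h2⟩
        rw [hf.1.1 n _ (face_has_one g k hk i h1 h2), mul_zero]
  · obtain ⟨N, hN⟩ := hf.1.2
    refine ⟨N + 1, fun n g hn => ?_⟩
    rcases n with _ | n
    · rfl
    · change ∑ i : Fin (n + 2), (-1) ^ (i : ℕ) * f ⟨n, face i g⟩ = 0
      exact Finset.sum_eq_zero fun i _ => by rw [hN n _ (by omega), mul_zero]

theorem cup_mem {f f' : Simplex Γ → A} (hf : f ∈ augIdeal A Γ) (hf' : f' ∈ augIdeal A Γ) :
    cup A Γ f f' ∈ augIdeal A Γ := by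
  refine ⟨⟨?_, ?_⟩, ?_⟩
  · rintro n g ⟨k, hk⟩
    change ∑ i : Fin (n + 1), f (front i g) * f' (back i g) = 0
    refine Finset.sum_eq_zero fun i _ => ?_
    by_cases h : (k : ℕ) < i
    · rw [front, hf.1.1 _ _ ⟨⟨k, h⟩, hk⟩, zero_mul]
    · rw [back, hf'.1.1 _ _ ⟨⟨k - i, by omega⟩, ?_⟩, mul_zero]
      rw [← hk]
      congr 1
      exact Fin.ext (by simp; omega)
  · obtain ⟨N, hN⟩ := hf.1.2
    obtain ⟨N', hN'⟩ := hf'.1.2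
    refine ⟨N + N', fun n g hn => ?_⟩
    change ∑ i : Fin (n + 1), f (front i g) * f' (back i g) = 0
    refine Finset.sum_eq_zero fun i _ => ?_
    by_cases h : N < i
    · rw [front, hN _ _ h, zero_mul]
    · rw [back, hN' _ _ (by omega), mul_zero]
  · change ∑ i : Fin 1, f (front i Fin.elim0) * f' (back i Fin.elim0) = 0
    have h0 : f (front (0 : Fin 1) Fin.elim0) = 0 := augIdeal_zero hf _
    rw [Fin.sum_univ_one, h0, zero_mul]

variable (A Γ)

/-- The differential of the augmentation ideal. -/
def idealD : augIdeal A Γ →ₗ[A] augIdeal A Γ :=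
  (coboundary A Γ).restrict fun _ hf => coboundary_mem hf

/-- The cup product on the augmentation ideal. -/
def idealCup : augIdeal A Γ →ₗ[A] augIdeal A Γ →ₗ[A] augIdeal A Γ :=
  LinearMap.mk₂ A (fun f f' => ⟨cup A Γ f f', cup_mem f.2 f'.2⟩)
    (fun f f' h => Subtype.ext (by simp)) (fun a f h => Subtype.ext (by simp))
    (fun f h h' => Subtype.ext (by simp)) (fun a f h => Subtype.ext (by simp))

/-- The operator `f ↦ (-1)^{|f| - 1} f` on the augmentation ideal. -/
def idealSign : augIdeal A Γ →ₗ[A] augIdeal A Γ where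
  toFun f := ⟨fun σ => (-1) ^ (σ.1 + 1) * (f : Simplex Γ → A) σ,
    ⟨⟨fun n g hg => by simp [f.2.1.1 n g hg], f.2.1.2.imp fun N hN n g hn => by simp [hN n g hn]⟩,
      by
        have := augIdeal_zero f.2 Fin.elim0
        change _ * _ = (0 : A)
        simp [this]⟩⟩
  map_add' f f' := Subtype.ext (funext fun σ => by simp [mul_add])
  map_smul' a f := Subtype.ext (funext fun σ => by simp [mul_left_comm])

/-- The elements of degree `p` of the augmentation ideal: cochains supported on `p`-simplices. -/
def idealDegree (p : ℕ) : Submodule A (augIdeal A Γ) where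
  carrier := {f | ∀ σ : Simplex Γ, σ.1 ≠ p → (f : Simplex Γ → A) σ = 0}
  zero_mem' := fun _ _ => rfl
  add_mem' := fun {f f'} h h' σ hσ => by simp [h σ hσ, h' σ hσ]
  smul_mem' := fun a f h σ hσ => by simp [h σ hσ]

end Cochains

/-! ### Bar cohomology of a group -/

section BarCohomology

variable (A : Type*) [CommRing A] (Γ : Type*) [Group Γ]

/-- The underlying module of `Bar(Γ;A) = T(s⁻¹ C̄^*(BΓ;A))`. -/
abbrev Bar : Type _ := TensorCoalgebra A (augIdeal A Γ)

/-- The differential of `Bar(Γ;A)`. -/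
def barD : Bar A Γ →ₗ[A] Bar A Γ :=
  barDifferential (idealSign A Γ) (idealD A Γ) (idealCup A Γ)

/-- `Bar(Γ;A)` vanishes in negative degrees, since `BΓ` has a single vertex. -/
theorem barDegree_eq_bot_of_neg (k : ℤ) (hk : k < 0) : barDegree (idealDegree A Γ) k = ⊥ := by
  rw [barDegree, Submodule.span_eq_bot]
  rintro T ⟨n, p, c, hc, hp, rfl⟩
  have : ∃ i, p i = 0 := by
    by_contra! h
    have : 0 ≤ ∑ i, ((p i : ℤ) - 1) := Finset.sum_nonneg fun i _ => by
      have := h i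
      omega
    omega
  obtain ⟨i, hi⟩ := this
  have hci : c i = 0 := by
    refine Subtype.ext (funext ?_)
    rintro ⟨m, g⟩
    by_cases hm : m = 0
    · subst hm
      exact augIdeal_zero (c i).2 g
    · exact hc i ⟨m, g⟩ (by rw [hi]; exact hm)
  rw [TensorCoalgebra.word, (PiTensorProduct.tprod A).map_coord_zero i hci, map_zero]

/-- The Bar cohomology `H⁰_Bar(Γ;A)`. Since `Bar(Γ;A)` vanishes in degree `-1` by the preceding fact,
there are no coboundaries in degree zero, and `H⁰` is the module of cocycles of degree zero. -/
def H0Bar : Submodule A (Bar A Γ) :=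
  barDegree (idealDegree A Γ) 0 ⊓ LinearMap.ker (barD A Γ)

/-- A coalgebra structure on `H⁰_Bar(Γ;A)` is the one coming from `Bar(Γ;A)` if the inclusion of the
cocycles is a homomorphism of coalgebras. -/
def IsBarCoalgebra (c : Coalgebra A (H0Bar A Γ)) : Prop :=
  TensorProduct.map (H0Bar A Γ).subtype (H0Bar A Γ).subtype ∘ₗ c.comul =
      CoalgebraStruct.comul ∘ₗ (H0Bar A Γ).subtype ∧
    c.counit = CoalgebraStruct.counit ∘ₗ (H0Bar A Γ).subtype

variable {Γ}

/-- Pullback of cochains along the simplicial map `BΓ' → BΓ` induced by a homomorphism `Γ' → Γ`. -/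
def pullbackIdeal {Γ' : Type*} [Group Γ'] (h : Γ' →* Γ) : augIdeal A Γ →ₗ[A] augIdeal A Γ' where
  toFun f := ⟨fun σ => (f : Simplex Γ → A) ⟨σ.1, fun i => h (σ.2 i)⟩,
    ⟨⟨fun n g ⟨i, hi⟩ => f.2.1.1 n _ ⟨i, by simp [hi]⟩,
      f.2.1.2.imp fun N hN n g hn => hN n _ hn⟩, augIdeal_zero f.2 _⟩⟩
  map_add' _ _ := rfl
  map_smul' _ _ := rfl

theorem pullbackIdeal_d {Γ' : Type*} [Group Γ'] (h : Γ' →* Γ) (f : augIdeal A Γ) :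
    pullbackIdeal A h (idealD A Γ f) = idealD A Γ' (pullbackIdeal A h f) := by
  refine Subtype.ext (funext ?_)
  rintro ⟨_ | n, g⟩
  · rfl
  · change ∑ i : Fin (n + 2), (-1) ^ (i : ℕ) * f.1 ⟨n, face i fun k => h (g k)⟩ =
      ∑ i : Fin (n + 2), (-1) ^ (i : ℕ) * f.1 ⟨n, fun k => h (face i g k)⟩
    refine Finset.sum_congr rfl fun i _ => ?_
    have hi : (face i fun k => h (g k)) = fun k => h (face i g k) := by
      cases i using Fin.cases with
      | zero => rfl
      | succ j => exact (Fin.comp_contractNth (· * ·) (· * ·) (f := h) (map_mul h) j g).symm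
    rw [hi]

theorem pullbackIdeal_cup {Γ' : Type*} [Group Γ'] (h : Γ' →* Γ) (f f' : augIdeal A Γ) :
    pullbackIdeal A h (idealCup A Γ f f') =
      idealCup A Γ' (pullbackIdeal A h f) (pullbackIdeal A h f') := rfl

theorem pullbackIdeal_sign {Γ' : Type*} [Group Γ'] (h : Γ' →* Γ) (f : augIdeal A Γ) :
    pullbackIdeal A h (idealSign A Γ f) = idealSign A Γ' (pullbackIdeal A h f) := rfl

/-- Pullback on Bar constructions along a group homomorphism. -/
def barPullback {Γ' : Type*} [Group Γ'] (h : Γ' →* Γ) : Bar A Γ →ₗ[A] Bar A Γ' :=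
  TensorCoalgebra.map (pullbackIdeal A h)

theorem barPullback_barD {Γ' : Type*} [Group Γ'] (h : Γ' →* Γ) (T : Bar A Γ) :
    barPullback A h (barD A Γ T) = barD A Γ' (barPullback A h T) := by
  suffices H : barPullback A h ∘ₗ barD A Γ = barD A Γ' ∘ₗ barPullback A h from
    LinearMap.congr_fun H T
  refine TensorCoalgebra.hom_ext fun n c => ?_
  simp only [LinearMap.comp_apply, barD, barPullback, TensorCoalgebra.map_word]
  cases n with
  | zero =>
    rw [barDifferential_word_zero, barDifferential_word_zero, map_zero]
  | succ n =>
    rw [barDifferential_word, barDifferential_word]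
    simp only [map_add, map_neg, map_sum, TensorCoalgebra.map_word]
    congr 1
    · congr 1
      refine Finset.sum_congr rfl fun i _ => ?_
      congr 1
      funext j
      split_ifs
      · rfl
      · exact pullbackIdeal_d A h _
      · rfl
    · congr 1
      refine Finset.sum_congr rfl fun i _ => ?_
      congr 1
      refine (Fin.comp_contractNth (fun a b => idealCup A Γ a b) (fun a b => idealCup A Γ' a b)
        (f := pullbackIdeal A h) (pullbackIdeal_cup A h) i.castSucc
        (fun j => (if j ≤ i.castSucc then idealSign A Γ else LinearMap.id) (c j))).trans ?_
      congr 1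
      funext j
      simp only [Function.comp_apply]
      split_ifs <;> rfl

theorem barPullback_mem {Γ' : Type*} [Group Γ'] (h : Γ' →* Γ) {T : Bar A Γ}
    (hT : T ∈ H0Bar A Γ) : barPullback A h T ∈ H0Bar A Γ' := by
  refine ⟨?_, ?_⟩
  · have h0 := hT.1
    rw [barDegree] at h0
    refine Submodule.span_induction (p := fun T _ => barPullback A h T ∈
      barDegree (idealDegree A Γ') 0) ?_ ?_ ?_ ?_ h0
    · rintro _ ⟨n, p, c, hc, hp, rfl⟩
      refine Submodule.subset_span ⟨n, p, fun i => pullbackIdeal A h (c i), ?_, hp, ?_⟩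
      · exact fun i σ hσ => hc i _ hσ
      · exact TensorCoalgebra.map_word _ _
    · simp
    · intro x y _ _ hx hy
      rw [map_add]
      exact add_mem hx hy
    · intro a x _ hx
      rw [map_smul]
      exact Submodule.smul_mem _ _ hx
  · have h1 : barD A Γ T = 0 := hT.2
    change barD A Γ' (barPullback A h T) = 0
    rw [← barPullback_barD, h1, map_zero]

/-- The pullback `h^* : H⁰_Bar(Γ;A) → H⁰_Bar(Γ';A)` along a group homomorphism `h : Γ' → Γ`. -/
def H0Bar.pullback {Γ' : Type*} [Group Γ'] (h : Γ' →* Γ) : H0Bar A Γ →ₗ[A] H0Bar A Γ' :=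
  (barPullback A h).restrict fun _ hT => barPullback_mem A h hT

variable {A}

/-- The pullback of a cochain to the standard circle, which has a single nondegenerate edge, along
the simplicial map `S¹ → BΓ` that sends this edge to the edge `w` of `BΓ`. -/
def evalEdge (w : Γ) : augIdeal A Γ →ₗ[A] A where
  toFun f := (f : Simplex Γ → A) ⟨1, fun _ => w⟩
  map_add' _ _ := rfl
  map_smul' _ _ := rfl

/-- The isomorphism `H⁰_Bar(S¹;A) = T(A) ≅ A[t]`, `a₁|⋯|aₙ ↦ a₁ ⋯ aₙ tⁿ`. -/
def circleToPolynomial : TensorCoalgebra A A →ₗ[A] Polynomial A :=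
  TensorCoalgebra.desc fun n =>
    Polynomial.monomial n ∘ₗ PiTensorProduct.lift (MultilinearMap.mkPiAlgebra A (Fin n) A)

/-- The letter-braiding polynomial `L_T(w) ∈ A[t]` of `w ∈ Γ` associated to `T ∈ H⁰_Bar(Γ;A)`. -/
def letterBraidingPolynomial (T : H0Bar A Γ) (w : Γ) : Polynomial A :=
  circleToPolynomial (TensorCoalgebra.map (evalEdge w) (T : Bar A Γ))

/-- The letter-braiding number `ℓ_T(w)`: the linear coefficient of `L_T(w)`. -/
def letterBraidingNumber (T : H0Bar A Γ) (w : Γ) : A :=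
  (letterBraidingPolynomial T w).coeff 1

end BarCohomology

/-! ### Free groups and presentations -/

section Free

variable (A : Type*) [CommRing A] (S : Type*)

/-- The pullback of cochains to the wedge of circles `X_S = ⋁_{s ∈ S} S¹`, whose nondegenerate simplices
are a vertex and the edges `s ∈ S`, along the simplicial map `X_S → BF_S` that sends the edge `s` to
the edge `s`. The augmentation ideal of `C^*(X_S;A)` is `A^S`, in degree one, with zero product. -/
def restrictToLetters : augIdeal A (FreeGroup S) →ₗ[A] (S → A) :=
  LinearMap.pi fun s => evalEdge (FreeGroup.of s)

/-- The comparison map `H⁰_Bar(F_S;A) → H⁰_Bar(X_S;A) = T(A^S)`. -/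
def freeComparison : H0Bar A (FreeGroup S) →ₗ[A] TensorCoalgebra A (S → A) :=
  TensorCoalgebra.map (restrictToLetters A S) ∘ₗ (H0Bar A (FreeGroup S)).subtype

variable {A S}

/-- The letter-braiding number `ℓ_T(w)` of a word `w ∈ F_S` associated to `T ∈ T(A^S)`, through the
identification of `T(A^S)` with `H⁰_Bar(F_S;A)` by the (bijective) comparison map. -/
def freeLetterBraidingNumber (T : TensorCoalgebra A (S → A)) (w : FreeGroup S) : A :=
  letterBraidingNumber (Function.invFun (freeComparison A S) T) w

variable (A)

/-- The map `p^* : H⁰_Bar(⟨S|R⟩;A) → H⁰_Bar(F_S;A) ≅ T(A^S)` induced by the quotient map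
`p : F_S → ⟨S|R⟩`. -/
def presentationPullback (R : Set (FreeGroup S)) :
    H0Bar A (PresentedGroup R) →ₗ[A] TensorCoalgebra A (S → A) :=
  freeComparison A S ∘ₗ H0Bar.pullback A (PresentedGroup.mk R)

end Free

/-- A submodule `H` of a coalgebra `B` is a sub-coalgebra if `Δ(H)` lies in the image of `H ⊗ H` in
`B ⊗ B`. -/
def IsSubcoalgebra {A B : Type*} [CommRing A] [AddCommGroup B] [Module A B] [Coalgebra A B]
    (H : Submodule A B) : Prop :=
  ∀ x ∈ H, CoalgebraStruct.comul (R := A) x ∈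
    LinearMap.range (TensorProduct.map H.subtype H.subtype)

end LetterBraiding

end

open scoped TensorProduct DirectSum

noncomputable section

/-! The linear dual of `T(V)` is an algebra under convolution. The argument describes submodules of
`T(V)` by the functionals that vanish on them and turns coalgebra questions into algebra in this
dual. What makes this possible over a principal ideal domain is `Separates.tensor`: if functionals
separate the points of `V` and of `W`, their products separate the points of `V ⊗ W`. The reason is
that a tensor only involves a finitely generated submodule of `V`, which is torsion free and
therefore free. Hence words of evaluations separate the points of `T(V)` (`separates_ev`), and a
tensor killed by suitable products of functionals comes from the tensor product of their common
kernels (`mem_range_map`). No freeness of the cochain modules is needed, so `S` and `R` may be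
infinite.

Write `E(g)` for evaluation on the edge `g`. A degree zero element `T` of the Bar construction is a
cocycle exactly when every functional `u * (E(gh) - E(g) - E(h) - E(g) * E(h)) * v` kills it, for
`u` and `v` words of evaluations (`mem_H0Bar_iff`). This family of conditions is stable under
multiplication on either side by words of evaluations, so `H⁰_Bar` is a sub-coalgebra, and it
inherits a unique coalgebra structure.

For a free group, a cocycle is determined by its values on words in the generators: on words of
maximal length it is additive in each entry, and one descends on the length
(`eq_zero_of_ev_letters`). Conversely, the Magnus expansion `s ↦ 1 + letterEval s` takes values in
units of the dual of `T(A^S)`, and its reduced form `M(g) - 1` satisfies the same equation as `E`.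
Cutting a word into nonempty blocks and reading each block as a coefficient of `M - 1` gives a
cocycle with prescribed restriction (`exists_magnus_lift`).

For a presentation, let `H` be a sub-coalgebra whose letter-braiding numbers vanish on `R`. Its
annihilator is a two-sided ideal of the dual algebra. As `1 + E` is multiplicative, the words `w`
with `E(w)` in this ideal form a normal subgroup, which contains `R` and hence its normal closure.
So modulo the ideal `E(w)` depends only on the image of `w` in the quotient group. By
`mem_range_map_of_conv`, a cocycle of the free group whose evaluations only depend on images is
pulled back from the quotient. The other inclusion is formal: the pullback respects coproducts, and
a relation becomes a degenerate edge. -/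

namespace LetterBraiding

/-! ### Separating families of functionals over a principal ideal domain -/

section Separation

variable {A : Type*} [CommRing A]
variable {V : Type*} [AddCommGroup V] [Module A V] {W : Type*} [AddCommGroup W] [Module A W]

/-- A family of functionals separates points. -/
def Separates {ι : Type*} (lam : ι → V →ₗ[A] A) : Prop := ∀ v, (∀ i, lam i v = 0) → v = 0

/-- The functional `v ⊗ w ↦ f v * g w`. -/
def tensorFunctional (f : V →ₗ[A] A) (g : W →ₗ[A] A) : V ⊗[A] W →ₗ[A] A :=
  LinearMap.mul' A A ∘ₗ TensorProduct.map f g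

@[simp]
theorem tensorFunctional_tmul (f : V →ₗ[A] A) (g : W →ₗ[A] A) (v : V) (w : W) :
    tensorFunctional f g (v ⊗ₜ w) = f v * g w := rfl

theorem tensorFunctional_map {V' W' : Type*} [AddCommGroup V'] [Module A V'] [AddCommGroup W']
    [Module A W'] (f : V →ₗ[A] A) (g : W →ₗ[A] A) (a : V' →ₗ[A] V) (b : W' →ₗ[A] W)
    (z : V' ⊗[A] W') :
    tensorFunctional f g (TensorProduct.map a b z) = tensorFunctional (f ∘ₗ a) (g ∘ₗ b) z := by
  simp only [tensorFunctional, LinearMap.comp_apply, TensorProduct.map_comp]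

theorem Separates.of_injective {ι : Type*} {lam : ι → V →ₗ[A] A} (h : Separates lam)
    {f : W →ₗ[A] V} (hf : Function.Injective f) : Separates fun i => lam i ∘ₗ f :=
  fun w hw => hf (by rw [map_zero]; exact h _ hw)

theorem Separates.isTorsionFree [IsDomain A] {ι : Type*} {lam : ι → V →ₗ[A] A}
    (h : Separates lam) : Module.IsTorsionFree A V := by
  refine Module.isTorsionFree_iff_smul_eq_zero.2 ?_
  intro a v hav
  by_cases ha : a = 0
  · exact Or.inl ha
  · refine Or.inr (h v fun i => ?_)
    have := congrArg (lam i) hav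
    rw [map_smul, map_zero, smul_eq_mul] at this
    exact (mul_eq_zero.1 this).resolve_left ha

/-- A tensor comes from `V₀ ⊗ W` with `V₀` finitely generated, and `V₀` is free because `V` is
torsion free. Contracting with `phi k` leaves an element of `V₀` that every `lam i` kills, hence
zero. So each coordinate of the tensor in a basis of `V₀`, an element of `W`, is killed by every
`phi k`. -/
theorem Separates.tensor [IsDomain A] [IsPrincipalIdealRing A] {ι κ : Type*}
    {lam : ι → V →ₗ[A] A} {phi : κ → W →ₗ[A] A} (hl : Separates lam) (hp : Separates phi) :
    Separates fun p : ι × κ => tensorFunctional (lam p.1) (phi p.2) := by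
  intro z hz
  have := hl.isTorsionFree
  obtain ⟨V₀, hfin, hV₀⟩ := TensorProduct.exists_finite_submodule_left_of_setFinite {z}
    (Set.finite_singleton z)
  obtain ⟨z₀, rfl⟩ := hV₀ rfl
  have : Module.Free A V₀ := Module.free_of_finite_type_torsion_free'
  let b := Module.Free.chooseBasis A V₀
  -- The `lam i` still separate points on `V₀`, so no injectivity of `V₀ ⊗ W → V ⊗ W` is used.
  have key : ∀ k, LinearMap.lTensor V₀ (phi k) z₀ = 0 := fun k => by
    suffices TensorProduct.rid A V₀ (LinearMap.lTensor V₀ (phi k) z₀) = 0 by simpa using this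
    refine Subtype.ext (hl _ fun i => ?_)
    rw [← hz ⟨i, k⟩]
    refine Eq.trans ?_ (LinearMap.congr_fun (f := lam i ∘ₗ V₀.subtype ∘ₗ
      (TensorProduct.rid A V₀).toLinearMap ∘ₗ LinearMap.lTensor V₀ (phi k))
      (g := tensorFunctional (lam i) (phi k) ∘ₗ LinearMap.rTensor W V₀.subtype) ?_ z₀)
    · rfl
    · ext v w
      simp [mul_comm]
  have hz₀ : z₀ = 0 := by
    apply (TensorProduct.equivFinsuppOfBasisLeft (N := W) b).injective
    rw [map_zero]
    ext j
    refine hp _ fun k => ?_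
    have h2 := congrArg (fun t => LinearMap.mul' A A (LinearMap.rTensor A (b.coord j) t)) (key k)
    simp only [map_zero] at h2
    rw [← h2, TensorProduct.equivFinsuppOfBasisLeft_apply]
    refine LinearMap.congr_fun (f := phi k ∘ₗ (TensorProduct.lid A W).toLinearMap ∘ₗ
      LinearMap.rTensor W (b.coord j)) (g := LinearMap.mul' A A ∘ₗ
        LinearMap.rTensor A (b.coord j) ∘ₗ LinearMap.lTensor V₀ (phi k)) ?_ z₀
    ext v w
    simp
  rw [hz₀, map_zero]

/-- The common kernel of a family of functionals. -/
def commonKer {ι : Type*} (lam : ι → V →ₗ[A] A) : Submodule A V := ⨅ i, LinearMap.ker (lam i)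

@[simp]
theorem mem_commonKer {ι : Type*} {lam : ι → V →ₗ[A] A} {v : V} :
    v ∈ commonKer lam ↔ ∀ i, lam i v = 0 := by
  simp [commonKer]

variable [IsDomain A] [IsPrincipalIdealRing A]

/-- The `lam i` descend to the quotient by their common kernel and separate points there. So the
image of `z` in `(V ⧸ commonKer lam) ⊗ W` vanishes, and right exactness of the tensor product
applies. -/
theorem mem_range_rTensor {ι κ : Type*} {lam : ι → V →ₗ[A] A} {phi : κ → W →ₗ[A] A}
    (hp : Separates phi) {z : V ⊗[A] W} (hz : ∀ i k, tensorFunctional (lam i) (phi k) z = 0) :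
    z ∈ LinearMap.range (LinearMap.rTensor W (commonKer lam).subtype) := by
  let lam' : ι → (V ⧸ commonKer lam) →ₗ[A] A := fun i =>
    (commonKer lam).liftQ (lam i) fun v hv => mem_commonKer.1 hv i
  have hl : Separates lam' := by
    intro v hv
    obtain ⟨v, rfl⟩ := (commonKer lam).mkQ_surjective v
    exact (Submodule.Quotient.mk_eq_zero _).2 (mem_commonKer.2 fun i => hv i)
  have hex := rTensor_exact W (f := (commonKer lam).subtype) (g := (commonKer lam).mkQ)
    (by intro x; simp) (commonKer lam).mkQ_surjective
  refine (hex z).1 (hl.tensor hp _ ?_)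
  rintro ⟨i, k⟩
  rw [← hz i k, LinearMap.rTensor, tensorFunctional_map]
  rfl

theorem mem_range_lTensor {ι κ : Type*} {lam : ι → V →ₗ[A] A} {phi : κ → W →ₗ[A] A}
    (hl : Separates lam) {z : V ⊗[A] W} (hz : ∀ i k, tensorFunctional (lam i) (phi k) z = 0) :
    z ∈ LinearMap.range (LinearMap.lTensor V (commonKer phi).subtype) := by
  have h := mem_range_rTensor (lam := phi) (phi := lam) (z := TensorProduct.comm A V W z) hl ?_
  · obtain ⟨y, hy⟩ := h
    refine ⟨TensorProduct.comm A _ _ y, ?_⟩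
    apply (TensorProduct.comm A V W).injective
    rw [← hy]
    refine LinearMap.congr_fun (f := (TensorProduct.comm A V W).toLinearMap ∘ₗ
      LinearMap.lTensor V (commonKer phi).subtype ∘ₗ (TensorProduct.comm A _ _).toLinearMap) ?_ y
    ext
    rfl
  · intro k i
    rw [← hz i k]
    refine LinearMap.congr_fun (f := tensorFunctional (phi k) (lam i) ∘ₗ
      (TensorProduct.comm A V W).toLinearMap) ?_ z
    ext
    simp [mul_comm]

/-- The two factors are treated in turn: after the left factor has been cut down to `commonKer
lam'`, the restrictions of `lam` still separate its points, so the right factor can be cut down in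
the same way. This is the tool for showing that a coproduct lands in a tensor product of submodules.
-/
theorem mem_range_map {ι κ ι' κ' : Type*} {lam : ι → V →ₗ[A] A} {phi : κ → W →ₗ[A] A}
    {lam' : ι' → V →ₗ[A] A} {phi' : κ' → W →ₗ[A] A}
    (hl : Separates lam) (hp : Separates phi) {z : V ⊗[A] W}
    (h₁ : ∀ i k, tensorFunctional (lam' i) (phi k) z = 0)
    (h₂ : ∀ i k, tensorFunctional (lam i) (phi' k) z = 0) :
    z ∈ LinearMap.range (TensorProduct.map (commonKer lam').subtype (commonKer phi').subtype) := by
  obtain ⟨y, rfl⟩ := mem_range_rTensor hp h₁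
  have hy := mem_range_lTensor (hl.of_injective (commonKer lam').injective_subtype) (phi := phi')
    (z := y) (fun i k => by
      rw [← h₂ i k, LinearMap.rTensor, tensorFunctional_map]
      rfl)
  obtain ⟨x, rfl⟩ := hy
  refine ⟨x, ?_⟩
  rw [← LinearMap.comp_apply, LinearMap.rTensor_comp_lTensor]

end Separation

/-! ### The tensor coalgebra and its convolution dual -/

namespace TensorCoalgebra

variable {A : Type*} [CommRing A] {V : Type*} [AddCommGroup V] [Module A V]
variable {W : Type*} [AddCommGroup W] [Module A W] {X : Type*}

theorem comul_listWord (l : List V) :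
    CoalgebraStruct.comul (R := A) (listWord l : TensorCoalgebra A V) =
      ∑ i ∈ Finset.range (l.length + 1), listWord (l.take i) ⊗ₜ[A] listWord (l.drop i) :=
  deconcat_listWord l

theorem counit_listWord (l : List V) :
    CoalgebraStruct.counit (R := A) (listWord l : TensorCoalgebra A V) =
      if l.length = 0 then 1 else 0 :=
  wtZero_listWord l

theorem map_listWord (f : V →ₗ[A] W) (l : List V) :
    map f (listWord l : TensorCoalgebra A V) = listWord (l.map f) := by
  rw [listWord, map_word]
  exact word_congr (by simp) (by simp)

/-- The projection to the weight one part. -/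
def letter : TensorCoalgebra A V →ₗ[A] V :=
  desc fun n => match n with
    | 1 => (PiTensorProduct.subsingletonEquiv (R := A) (s := fun _ : Fin 1 => V) 0).toLinearMap
    | _ => 0

@[simp]
theorem letter_nil : letter (listWord [] : TensorCoalgebra A V) = 0 := by
  rw [letter, listWord, desc_word]; rfl

@[simp]
theorem letter_singleton (c : V) : letter (listWord [c] : TensorCoalgebra A V) = c := by
  rw [letter, listWord, desc_word]
  exact PiTensorProduct.subsingletonEquiv_apply_tprod (s := fun _ : Fin 1 => V) 0 _

@[simp]
theorem letter_cons_cons (c c' : V) (l : List V) :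
    letter (listWord (c :: c' :: l) : TensorCoalgebra A V) = 0 := by
  rw [letter, listWord, desc_word]; rfl

theorem letter_of_length_ne {l : List V} (h : l.length ≠ 1) :
    letter (listWord l : TensorCoalgebra A V) = 0 := by
  rcases l with _ | ⟨a, _ | ⟨b, l⟩⟩
  · simp
  · simp at h
  · simp

theorem letter_map (f : V →ₗ[A] W) (T : TensorCoalgebra A V) : letter (map f T) = f (letter T) := by
  suffices letter ∘ₗ map f = f ∘ₗ (letter : TensorCoalgebra A V →ₗ[A] V) from
    LinearMap.congr_fun this T
  refine listHom_ext fun l => ?_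
  rcases l with _ | ⟨a, _ | ⟨b, l⟩⟩ <;> simp [map_listWord]

/-- Prepending a letter to tensors of weight `n`. -/
def consWeight (n : ℕ) : V →ₗ[A] (⨂[A]^n V) →ₗ[A] ⨂[A]^(n + 1) V :=
  (PiTensorProduct.lift (R := A) (s := fun _ : Fin n => V)).toLinearMap ∘ₗ
    (PiTensorProduct.tprod A (s := fun _ : Fin (n + 1) => V)).curryLeft

/-- Prepending a letter: `v ↦ c₁|⋯|cₙ ↦ v|c₁|⋯|cₙ`. -/
def cons : V →ₗ[A] TensorCoalgebra A V →ₗ[A] TensorCoalgebra A V where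
  toFun v := desc fun n => incl A V (n + 1) ∘ₗ consWeight n v
  map_add' v w := by
    refine hom_ext fun n c => ?_
    simp only [LinearMap.add_apply, desc_word, map_add, LinearMap.comp_apply]
  map_smul' a v := by
    refine hom_ext fun n c => ?_
    simp only [LinearMap.smul_apply, desc_word, map_smul, LinearMap.comp_apply, RingHom.id_apply]

theorem cons_word (v : V) {n : ℕ} (c : Fin n → V) :
    cons v (word c : TensorCoalgebra A V) = word (Fin.cons v c : Fin (n + 1) → V) := by
  change desc _ (word c) = _
  rw [desc_word, LinearMap.comp_apply, word]
  congr 1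
  simp [consWeight]

@[simp]
theorem cons_listWord (v : V) (l : List V) :
    cons v (listWord l : TensorCoalgebra A V) = listWord (v :: l) := by
  rw [listWord, cons_word]
  refine word_congr (by simp) ?_
  intro i
  refine Fin.cases ?_ (fun i => ?_) i <;> simp

theorem map_cons (f : V →ₗ[A] W) (v : V) (T : TensorCoalgebra A V) :
    map f (cons v T) = cons (f v) (map f T) := by
  suffices map f ∘ₗ cons v = cons (f v) ∘ₗ map f from LinearMap.congr_fun this T
  refine listHom_ext fun l => ?_
  simp [map_listWord]

/-- Splitting off the first letter. -/
def uncons : TensorCoalgebra A V →ₗ[A] V ⊗[A] TensorCoalgebra A V :=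
  LinearMap.rTensor _ letter ∘ₗ CoalgebraStruct.comul

@[simp]
theorem uncons_nil : uncons (listWord [] : TensorCoalgebra A V) = 0 := by
  rw [uncons, LinearMap.comp_apply, comul_listWord]
  simp

@[simp]
theorem uncons_listWord_cons (c : V) (l : List V) :
    uncons (listWord (c :: l) : TensorCoalgebra A V) = c ⊗ₜ listWord l := by
  rw [uncons, LinearMap.comp_apply, comul_listWord, map_sum, Finset.sum_eq_single 1]
  · simp
  · intro i hi h1
    rw [LinearMap.rTensor_tmul, letter_of_length_ne, TensorProduct.zero_tmul]
    simp only [Finset.mem_range] at hi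
    rw [List.length_take]
    omega
  · simp

theorem uncons_cons (c : V) (T : TensorCoalgebra A V) : uncons (cons c T) = c ⊗ₜ T := by
  suffices uncons ∘ₗ cons c = TensorProduct.mk A V (TensorCoalgebra A V) c from
    LinearMap.congr_fun this T
  exact listHom_ext fun l => by simp

/-- The decomposition `T(V) = A ⊕ V ⊗ T(V)`, on which the inductions over the weight rest. -/
theorem eq_counit_add_cons_uncons (T : TensorCoalgebra A V) :
    T = CoalgebraStruct.counit (R := A) T • listWord [] + TensorProduct.lift cons (uncons T) := by
  suffices LinearMap.id = LinearMap.toSpanSingleton A (TensorCoalgebra A V) (listWord []) ∘ₗ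
      CoalgebraStruct.counit + TensorProduct.lift cons ∘ₗ uncons from LinearMap.congr_fun this T
  refine listHom_ext fun l => ?_
  rcases l with _ | ⟨a, l⟩ <;> simp [counit_listWord]

/-- The functional on `T(V)` that evaluates the single letter of a word of weight one. -/
def letterEval (f : V →ₗ[A] A) : WithConv (TensorCoalgebra A V →ₗ[A] A) :=
  WithConv.toConv (f ∘ₗ letter)

/-- The functional `c₁|⋯|cₙ ↦ e(x₁)(c₁) ⋯ e(xₙ)(cₙ)` on `T(V)`, zero on words of length different
from that of `x₁, …, xₙ`. -/
def ev (e : X → V →ₗ[A] A) (l : List X) : WithConv (TensorCoalgebra A V →ₗ[A] A) :=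
  (l.map fun x => letterEval (e x)).prod

theorem conv_apply (f g : WithConv (TensorCoalgebra A V →ₗ[A] A)) (T : TensorCoalgebra A V) :
    (f * g).ofConv T = tensorFunctional f.ofConv g.ofConv (CoalgebraStruct.comul T) := rfl

theorem letterEval_mul_apply (f : V →ₗ[A] A) (g : WithConv (TensorCoalgebra A V →ₗ[A] A))
    (T : TensorCoalgebra A V) :
    (letterEval f * g).ofConv T = tensorFunctional f g.ofConv (uncons T) := by
  rw [conv_apply, uncons, LinearMap.comp_apply, LinearMap.rTensor, tensorFunctional_map]
  rfl

theorem conv_cons (f : V →ₗ[A] A) (g : WithConv (TensorCoalgebra A V →ₗ[A] A)) (v : V)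
    (T : TensorCoalgebra A V) : (letterEval f * g).ofConv (cons v T) = f v * g.ofConv T := by
  rw [letterEval_mul_apply, uncons_cons, tensorFunctional_tmul]

theorem letterEval_mul_nil (f : V →ₗ[A] A) (g : WithConv (TensorCoalgebra A V →ₗ[A] A)) :
    (letterEval f * g).ofConv (listWord []) = 0 := by
  rw [letterEval_mul_apply, uncons_nil, map_zero]

theorem letterEval_mul_cons (f : V →ₗ[A] A) (g : WithConv (TensorCoalgebra A V →ₗ[A] A)) (c : V)
    (l : List V) :
    (letterEval f * g).ofConv (listWord (c :: l)) = f c * g.ofConv (listWord l) := by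
  rw [← cons_listWord, conv_cons]

section ev

variable (e : X → V →ₗ[A] A)

@[simp]
theorem ev_nil (T : TensorCoalgebra A V) :
    (ev e []).ofConv T = CoalgebraStruct.counit (R := A) T := rfl

theorem ev_nil_eq_one : ev e [] = 1 := rfl

theorem ev_append (l l' : List X) : ev e (l ++ l') = ev e l * ev e l' := by
  simp [ev]

theorem ev_cons (x : X) (l : List X) : ev e (x :: l) = letterEval (e x) * ev e l := by
  simp [ev]

theorem ev_cons_apply (x : X) (l : List X) (T : TensorCoalgebra A V) :
    (ev e (x :: l)).ofConv T = tensorFunctional (e x) (ev e l).ofConv (uncons T) := by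
  rw [ev_cons, letterEval_mul_apply]

@[simp]
theorem ev_cons_cons (x : X) (l : List X) (v : V) (T : TensorCoalgebra A V) :
    (ev e (x :: l)).ofConv (cons v T) = e x v * (ev e l).ofConv T := by
  rw [ev_cons, conv_cons]

@[simp]
theorem ev_cons_listWord (x : X) (l : List X) (v : V) (cs : List V) :
    (ev e (x :: l)).ofConv (listWord (v :: cs)) = e x v * (ev e l).ofConv (listWord cs) := by
  rw [← cons_listWord, ev_cons_cons]

@[simp]
theorem ev_cons_nil (x : X) (l : List X) :
    (ev e (x :: l)).ofConv (listWord [] : TensorCoalgebra A V) = 0 := by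
  rw [ev_cons_apply, uncons_nil, map_zero]

@[simp]
theorem ev_nil_cons (v : V) (cs : List V) :
    (ev e []).ofConv (listWord (v :: cs) : TensorCoalgebra A V) = 0 := by
  simp [counit_listWord]

theorem ev_nil_cons_apply (v : V) (T : TensorCoalgebra A V) :
    (ev e []).ofConv (cons v T) = 0 := by
  suffices (ev e []).ofConv ∘ₗ cons v = 0 from LinearMap.congr_fun this T
  refine listHom_ext fun l => ?_
  rw [LinearMap.comp_apply, cons_listWord, ev_nil_cons]
  rfl

theorem ev_of_length_ne {l : List X} {cs : List V} (h : l.length ≠ cs.length) :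
    (ev e l).ofConv (listWord cs) = 0 := by
  induction l generalizing cs with
  | nil =>
    rw [ev_nil, counit_listWord, if_neg (fun h' => h (by simp [h']))]
  | cons x l ih =>
    rcases cs with _ | ⟨c, cs⟩
    · simp
    · rw [ev_cons_listWord, ih (by simpa using h), mul_zero]

theorem letterEval_apply (f : V →ₗ[A] A) (T : TensorCoalgebra A V) :
    (letterEval f).ofConv T = f (letter T) := rfl

theorem ev_map (f : W →ₗ[A] V) (l : List X) (T : TensorCoalgebra A W) :
    (ev e l).ofConv (map f T) = (ev (fun x => e x ∘ₗ f) l).ofConv T := by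
  suffices (ev e l).ofConv ∘ₗ map f = (ev (fun x => e x ∘ₗ f) l).ofConv from
    LinearMap.congr_fun this T
  refine listHom_ext fun cs => ?_
  rw [LinearMap.comp_apply, map_listWord]
  induction l generalizing cs with
  | nil => rcases cs with _ | ⟨c, cs⟩ <;> simp [counit_listWord]
  | cons x l ih => rcases cs with _ | ⟨c, cs⟩ <;> simp [ih]

theorem ev_comp {Y : Type*} (f : Y → X) (l : List Y) :
    ev (fun y => e (f y)) l = ev e (l.map f) := by
  simp [ev, Function.comp_def]

end ev

section Weight

variable (A V)

/-- The tensors of weight at most `n`. -/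
def weightLE (n : ℕ) : Submodule A (TensorCoalgebra A V) :=
  Submodule.span A {T | ∃ l : List V, l.length ≤ n ∧ T = listWord l}

variable {A V}

theorem listWord_mem_weightLE {n : ℕ} {l : List V} (h : l.length ≤ n) :
    (listWord l : TensorCoalgebra A V) ∈ weightLE A V n :=
  Submodule.subset_span ⟨l, h, rfl⟩

theorem span_listWord :
    Submodule.span A (Set.range (listWord : List V → TensorCoalgebra A V)) = ⊤ := by
  have h : (Submodule.span A (Set.range (listWord : List V → TensorCoalgebra A V))).mkQ = 0 :=
    listHom_ext fun l => (Submodule.Quotient.mk_eq_zero _).2 (Submodule.subset_span ⟨l, rfl⟩)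
  rw [← Submodule.ker_mkQ (Submodule.span A (Set.range listWord)), h, LinearMap.ker_zero]

theorem weightLE_mono {m n : ℕ} (h : m ≤ n) : weightLE A V m ≤ weightLE A V n :=
  Submodule.span_mono fun _ ⟨l, hl, e⟩ => ⟨l, hl.trans h, e⟩

theorem exists_mem_weightLE (T : TensorCoalgebra A V) : ∃ n, T ∈ weightLE A V n := by
  have hT : T ∈ Submodule.span A (Set.range (listWord : List V → TensorCoalgebra A V)) := by
    rw [span_listWord]; trivial
  induction hT using Submodule.span_induction with
  | mem x h =>
    obtain ⟨l, rfl⟩ := h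
    exact ⟨l.length, listWord_mem_weightLE le_rfl⟩
  | zero => exact ⟨0, zero_mem _⟩
  | add x y _ _ hx hy =>
    obtain ⟨m, hm⟩ := hx
    obtain ⟨n, hn⟩ := hy
    exact ⟨max m n, add_mem (weightLE_mono (le_max_left _ _) hm)
      (weightLE_mono (le_max_right _ _) hn)⟩
  | smul a x _ hx =>
    obtain ⟨m, hm⟩ := hx
    exact ⟨m, Submodule.smul_mem _ _ hm⟩

theorem ev_eq_zero_of_mem_weightLE (e : X → V →ₗ[A] A) {n : ℕ} {T : TensorCoalgebra A V}
    (hT : T ∈ weightLE A V n) {l : List X} (hl : n < l.length) : (ev e l).ofConv T = 0 := by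
  suffices weightLE A V n ≤ LinearMap.ker (ev e l).ofConv from this hT
  rw [weightLE, Submodule.span_le]
  rintro _ ⟨cs, hcs, rfl⟩
  exact ev_of_length_ne e (by omega)

theorem uncons_mem_range {n : ℕ} {T : TensorCoalgebra A V} (hT : T ∈ weightLE A V (n + 1)) :
    uncons T ∈ LinearMap.range (LinearMap.lTensor V (weightLE A V n).subtype) := by
  suffices weightLE A V (n + 1) ≤
      (LinearMap.range (LinearMap.lTensor V (weightLE A V n).subtype)).comap uncons from this hT
  rw [weightLE, Submodule.span_le]
  rintro _ ⟨_ | ⟨c, cs⟩, hcs, rfl⟩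
  · simp
  · rw [SetLike.mem_coe, Submodule.mem_comap, uncons_listWord_cons]
    refine ⟨c ⊗ₜ ⟨listWord cs, listWord_mem_weightLE (by simpa using hcs)⟩, rfl⟩

theorem uncons_eq_zero {T : TensorCoalgebra A V} (hT : T ∈ weightLE A V 0) : uncons T = 0 := by
  suffices weightLE A V 0 ≤ LinearMap.ker uncons from this hT
  rw [weightLE, Submodule.span_le]
  rintro _ ⟨cs, hcs, rfl⟩
  rw [List.length_eq_zero_iff.1 (Nat.le_zero.1 hcs)]
  exact uncons_nil

end Weight

section Separation

variable [IsDomain A] [IsPrincipalIdealRing A]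

/-- Induction on a bound for the weight: the empty word detects the constant term, and the words
beginning with `x` test `uncons T` by `e x` on the first letter and by shorter words on the
remainder, so that `Separates.tensor` applies. -/
theorem separates_ev {e : X → V →ₗ[A] A} (he : Separates e) :
    Separates fun l : List X => (ev e l).ofConv := by
  suffices ∀ n, ∀ T ∈ weightLE A V n, (∀ l, (ev e l).ofConv T = 0) → T = 0 by
    intro T hT
    obtain ⟨n, hn⟩ := exists_mem_weightLE T
    exact this n T hn hT
  intro n
  induction n with
  | zero =>
    intro T hT h
    rw [eq_counit_add_cons_uncons T, uncons_eq_zero hT, ← ev_nil e, h]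
    simp
  | succ n ih =>
    intro T hT h
    obtain ⟨z, hz⟩ := uncons_mem_range hT
    -- The second tensor factor is taken to be `weightLE A V n` rather than `T(V)`, where the
    -- inductive hypothesis gives separation.
    have hs : Separates fun l : List X => (ev e l).ofConv ∘ₗ (weightLE A V n).subtype :=
      fun y hy => Subtype.ext (ih y.1 y.2 hy)
    have hz0 : z = 0 := he.tensor hs z fun p => by
      rw [← h (p.1 :: p.2), ev_cons_apply, ← hz, LinearMap.lTensor, tensorFunctional_map]
      rfl
    rw [eq_counit_add_cons_uncons T, ← hz, hz0, ← ev_nil e, h]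
    simp

/-- The hypothesis says that `lam i` kills every letter of `T`, whatever words of evaluations are
applied before and after it. Splitting off the first letter leaves a tensor in the product of
`commonKer lam` with the elements of smaller weight satisfying the same condition, and induction
applies. -/
theorem mem_range_map_of_conv {e : X → V →ₗ[A] A} (he : Separates e) {ι : Type*}
    {lam : ι → V →ₗ[A] A} {q : W →ₗ[A] V} (hq : commonKer lam ≤ LinearMap.range q)
    {T : TensorCoalgebra A V}
    (hT : ∀ l i l', (ev e l * letterEval (lam i) * ev e l').ofConv T = 0) :
    T ∈ LinearMap.range (map q) := by
  -- The weight bound is restated as the vanishing of functionals, so that together with the other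
  -- conditions it defines a common kernel, as `mem_range_map` demands.
  suffices ∀ n, ∀ T : TensorCoalgebra A V, (∀ l, n < l.length → (ev e l).ofConv T = 0) →
      (∀ l i l', (ev e l * letterEval (lam i) * ev e l').ofConv T = 0) →
        T ∈ LinearMap.range (map q) by
    obtain ⟨n, hn⟩ := exists_mem_weightLE T
    exact this n T (fun l hl => ev_eq_zero_of_mem_weightLE e hn hl) hT
  have hnil : ∀ a : A, a • (listWord [] : TensorCoalgebra A V) ∈ LinearMap.range (map q) :=
    fun a => ⟨a • listWord [], by rw [map_smul, map_listWord]; rfl⟩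
  have hs := separates_ev he
  intro n
  induction n with
  | zero =>
    intro T h _
    have h0 : uncons T = 0 := he.tensor hs _ fun p => by
      rw [← ev_cons_apply, h _ (by simp)]
    rw [eq_counit_add_cons_uncons T, h0, map_zero, add_zero]
    exact hnil _
  | succ n ih =>
    intro T h hT
    let mu : {l : List X // n < l.length} ⊕ (List X × ι × List X) →
        TensorCoalgebra A V →ₗ[A] A := Sum.elim (fun l => (ev e l).ofConv)
      fun p => (ev e p.1 * letterEval (lam p.2.1) * ev e p.2.2).ofConv
    have hmu : commonKer mu ≤ LinearMap.range (map q) := by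
      intro T hT
      rw [mem_commonKer] at hT
      exact ih T (fun l hl => hT (Sum.inl ⟨l, hl⟩)) fun l i l' => hT (Sum.inr (l, i, l'))
    have hr := mem_range_map (lam' := lam) (phi' := mu) (z := uncons T) he hs
      (fun i l => by
        have := hT [] i l
        rwa [ev_nil_eq_one, one_mul, letterEval_mul_apply] at this)
      (fun x k => by
        rcases k with ⟨l, hl⟩ | ⟨l, i, l'⟩
        · exact (ev_cons_apply e x l T).symm.trans (h _ (by simpa using hl))
        · have := hT (x :: l) i l'
          rwa [ev_cons, mul_assoc, mul_assoc, ← mul_assoc (ev e l), letterEval_mul_apply] at this)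
    obtain ⟨y, hy⟩ := hr
    rw [eq_counit_add_cons_uncons T, ← hy]
    refine add_mem (hnil _) ?_
    clear hy
    induction y using TensorProduct.induction_on with
    | zero => simp
    | add x y hx hy => rw [map_add, map_add]; exact add_mem hx hy
    | tmul v t =>
      obtain ⟨w, hw⟩ := hq v.2
      obtain ⟨s, hs⟩ := hmu t.2
      refine ⟨cons w s, ?_⟩
      rw [map_cons, hw, hs]
      rfl

end Separation

end TensorCoalgebra

/-! ### The Bar differential, letter by letter -/

section BarRecursion

theorem contractNth_cons_zero {M : Type*} {n : ℕ} (f : M → M → M) (a : M) (w : Fin (n + 1) → M) :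
    Fin.contractNth (0 : Fin (n + 2)) f (Fin.cons a w : Fin (n + 2) → M) =
      Fin.cons (f a (w 0)) (Fin.tail w) := by
  funext j
  refine Fin.cases ?_ (fun j => ?_) j
  · simp [Fin.contractNth]
  · simp [Fin.contractNth, Fin.tail]

theorem contractNth_cons_succ {M : Type*} {n : ℕ} (f : M → M → M) (i : Fin (n + 1)) (a : M)
    (w : Fin (n + 1) → M) :
    Fin.contractNth i.succ f (Fin.cons a w : Fin (n + 2) → M) =
      Fin.cons a (Fin.contractNth i f w) := by
  funext j
  refine Fin.cases ?_ (fun j => ?_) j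
  · simp [Fin.contractNth]
  · simp only [Fin.contractNth, Fin.val_succ, Nat.succ_lt_succ_iff, Fin.cons_succ,
      Nat.succ_inj, ← Fin.succ_castSucc]

variable {A : Type*} [CommRing A] {V : Type*} [AddCommGroup V] [Module A V]

open TensorCoalgebra

/-- Multiplication into the first letter: `c₁|c₂|⋯|cₙ ↦ m(c₁)|c₂|⋯|cₙ`, zero in weight zero. -/
def mapFirst (m : V →ₗ[A] V) : TensorCoalgebra A V →ₗ[A] TensorCoalgebra A V :=
  TensorProduct.lift (cons ∘ₗ m) ∘ₗ uncons

theorem mapFirst_nil (m : V →ₗ[A] V) : mapFirst m (listWord [] : TensorCoalgebra A V) = 0 := by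
  simp [mapFirst]

theorem mapFirst_cons (m : V →ₗ[A] V) (c : V) (T : TensorCoalgebra A V) :
    mapFirst m (cons c T) = cons (m c) T := by
  simp [mapFirst, uncons_cons]

/-- The term at the first position of each of the two sums is split off: `d` acts on `c`, or `c` is
multiplied into the first letter of `T`. In all other terms the differential acts inside `T`, after
the sign operator has passed over `c`. -/
theorem barDifferential_cons (s d : V →ₗ[A] V) (μ : V →ₗ[A] V →ₗ[A] V) (c : V)
    (T : TensorCoalgebra A V) :
    barDifferential s d μ (cons c T) =
      -cons (d c) T - mapFirst (μ (s c)) T + cons (s c) (barDifferential s d μ T) := by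
  suffices barDifferential s d μ ∘ₗ cons c =
      -cons (d c) - mapFirst (μ (s c)) + cons (s c) ∘ₗ barDifferential s d μ from
    LinearMap.congr_fun this T
  refine hom_ext fun n w => ?_
  simp only [LinearMap.comp_apply, LinearMap.add_apply, LinearMap.sub_apply, LinearMap.neg_apply,
    cons_word]
  have hint : ∀ (m : ℕ) (w : Fin m → V), ∑ i : Fin (m + 1), (word (fun j : Fin (m + 1) =>
        (if j < i then s else if j = i then d else LinearMap.id)
          ((Fin.cons c w : Fin (m + 1) → V) j)) : TensorCoalgebra A V) =
      word (Fin.cons (d c) w : Fin (m + 1) → V) + ∑ i : Fin m, word (Fin.cons (s c)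
        (fun j : Fin m => (if j < i then s else if j = i then d else LinearMap.id) (w j)) :
          Fin (m + 1) → V) := by
    intro m w
    rw [Fin.sum_univ_succ]
    congr 1
    · congr 1
      funext j
      refine Fin.cases ?_ (fun j => ?_) j <;> simp
    · refine Finset.sum_congr rfl fun i _ => ?_
      congr 1
      funext j
      refine Fin.cases ?_ (fun j => ?_) j
      · simp
      · simp only [Fin.cons_succ, Fin.succ_lt_succ_iff, Fin.succ_inj]
  rw [barDifferential_word, hint]
  rcases n with _ | n
  · rw [barDifferential_word_zero, map_zero]
    have : (word w : TensorCoalgebra A V) = listWord [] := word_congr rfl (fun i => i.elim0)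
    rw [this, mapFirst_nil]
    simp
  · have hext : ∑ i : Fin (n + 1), (word (Fin.contractNth i.castSucc (fun a b => μ a b)
        fun j => (if j ≤ i.castSucc then s else LinearMap.id)
          ((Fin.cons c w : Fin (n + 2) → V) j)) : TensorCoalgebra A V) =
        word (Fin.cons (μ (s c) (w 0)) (Fin.tail w) : Fin (n + 1) → V) +
        ∑ i : Fin n, word (Fin.cons (s c) (Fin.contractNth i.castSucc (fun a b => μ a b)
          fun j => (if j ≤ i.castSucc then s else LinearMap.id) (w j)) : Fin (n + 1) → V) := by
      rw [Fin.sum_univ_succ]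
      congr 1
      · rw [Fin.castSucc_zero, ← contractNth_cons_zero (fun a b => μ a b)]
        congr 2
        funext j
        refine Fin.cases ?_ (fun j => ?_) j
        · simp
        · simp [Fin.succ_ne_zero]
      · refine Finset.sum_congr rfl fun i _ => ?_
        rw [← contractNth_cons_succ (fun a b => μ a b), Fin.succ_castSucc]
        congr 2
        funext j
        refine Fin.cases ?_ (fun j => ?_) j
        · simp
        · simp only [Fin.cons_succ, ← Fin.succ_castSucc, Fin.succ_le_succ_iff]
    have hfirst : mapFirst (μ (s c)) (word w : TensorCoalgebra A V) =
        word (Fin.cons (μ (s c) (w 0)) (Fin.tail w) : Fin (n + 1) → V) := by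
      conv_lhs => rw [← Fin.cons_self_tail w, ← cons_word, mapFirst_cons, cons_word]
    rw [hext, hfirst, barDifferential_word]
    simp only [map_add, map_neg, map_sum, cons_word]
    abel

end BarRecursion

/-! ### Edges and triangles of the classifying space -/

section Edges

variable {Γ : Type*}

/-- The edge of `BΓ` given by a group element. -/
def edge (g : Γ) : Simplex Γ := ⟨1, fun _ => g⟩

/-- The triangle of `BΓ` given by a pair of group elements. -/
def triangle (g h : Γ) : Simplex Γ := ⟨2, ![g, h]⟩

theorem exists_eq_edge {σ : Simplex Γ} (h : σ.1 = 1) : ∃ g, σ = edge g := by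
  obtain ⟨n, g⟩ := σ
  change n = 1 at h
  subst h
  refine ⟨g 0, ?_⟩
  rw [edge]
  congr 1
  funext i
  rw [Subsingleton.elim i 0]

theorem exists_eq_triangle {σ : Simplex Γ} (h : σ.1 = 2) : ∃ g g', σ = triangle g g' := by
  obtain ⟨n, g⟩ := σ
  change n = 2 at h
  subst h
  refine ⟨g 0, g 1, ?_⟩
  rw [triangle]
  congr 1
  funext i
  fin_cases i <;> rfl

theorem exists_eq_map_edge {l : List (Simplex Γ)} (h : ∀ σ ∈ l, σ.1 = 1) :
    ∃ gs : List Γ, l = gs.map edge := by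
  induction l with
  | nil => exact ⟨[], rfl⟩
  | cons σ l ih =>
    obtain ⟨gs, rfl⟩ := ih fun τ hτ => h τ (by simp [hτ])
    obtain ⟨g, rfl⟩ := exists_eq_edge (h σ (by simp))
    exact ⟨g :: gs, rfl⟩

/-- Words of simplices are sorted by their first entry that is not an edge. The differential of a
degree zero element has degree one, so it can only be detected when that entry is a triangle. -/
theorem exists_split (l : List (Simplex Γ)) : (∃ gs : List Γ, l = gs.map edge) ∨
    ∃ (gs : List Γ) (σ : Simplex Γ) (l' : List (Simplex Γ)), σ.1 ≠ 1 ∧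
      l = gs.map edge ++ σ :: l' := by
  induction l with
  | nil => exact Or.inl ⟨[], rfl⟩
  | cons σ l ih =>
    by_cases hσ : σ.1 = 1
    · obtain ⟨g, rfl⟩ := exists_eq_edge hσ
      rcases ih with ⟨gs, rfl⟩ | ⟨gs, τ, l', hτ, rfl⟩
      · exact Or.inl ⟨g :: gs, rfl⟩
      · exact Or.inr ⟨g :: gs, τ, l', hτ, rfl⟩
    · exact Or.inr ⟨[], σ, l, hσ, rfl⟩

end Edges

/-! ### Degree zero of the Bar construction -/

section Cocycles

open TensorCoalgebra

variable {A : Type*} [CommRing A] {Γ : Type*} [Group Γ]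

/-- Evaluation of cochains at a simplex. -/
def simplexEval (σ : Simplex Γ) : augIdeal A Γ →ₗ[A] A :=
  LinearMap.proj σ ∘ₗ (augIdeal A Γ).subtype

@[simp]
theorem simplexEval_apply (σ : Simplex Γ) (f : augIdeal A Γ) :
    simplexEval σ f = (f : Simplex Γ → A) σ := rfl

theorem separates_simplexEval :
    Separates (simplexEval : Simplex Γ → augIdeal A Γ →ₗ[A] A) :=
  fun _ hv => Subtype.ext (funext hv)

variable (A Γ) in
/-- The projection onto the cochains of degree one. -/
def degreeOne : augIdeal A Γ →ₗ[A] augIdeal A Γ where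
  toFun f := ⟨fun σ => if σ.1 = 1 then (f : Simplex Γ → A) σ else 0,
    ⟨⟨fun n g hg => by simp [f.2.1.1 n g hg], f.2.1.2.imp fun N hN n g hn => by simp [hN n g hn]⟩,
      rfl⟩⟩
  map_add' f f' := Subtype.ext (funext fun σ => by
    by_cases h : σ.1 = 1 <;> simp [h])
  map_smul' a f := Subtype.ext (funext fun σ => by
    by_cases h : σ.1 = 1 <;> simp [h])

theorem degreeOne_mem (f : augIdeal A Γ) : degreeOne A Γ f ∈ idealDegree A Γ 1 :=
  fun _ hσ => if_neg hσ

theorem listWord_mem_barDegree {cs : List (augIdeal A Γ)} (h : ∀ c ∈ cs, c ∈ idealDegree A Γ 1) :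
    (listWord cs : Bar A Γ) ∈ barDegree (idealDegree A Γ) 0 :=
  Submodule.subset_span ⟨cs.length, fun _ => 1, cs.get, fun i => h _ (List.get_mem _ _), by simp,
    rfl⟩

/-- The augmentation ideal has nothing in degree zero, so in a nonzero pure tensor every `p i - 1`
is nonnegative. If they sum to zero, every letter has degree one. -/
theorem barDegree_zero_eq_span : barDegree (idealDegree A Γ) 0 =
    Submodule.span A {T | ∃ cs : List (augIdeal A Γ), (∀ c ∈ cs, c ∈ idealDegree A Γ 1) ∧
      T = listWord cs} := by
  refine le_antisymm ?_ (Submodule.span_le.2 ?_)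
  · rw [barDegree, Submodule.span_le]
    rintro _ ⟨n, p, c, hc, hp, rfl⟩
    by_cases h0 : ∃ i, p i = 0
    · obtain ⟨i, hi⟩ := h0
      have hci : c i = 0 := by
        refine Subtype.ext (funext ?_)
        rintro ⟨m, g⟩
        by_cases hm : m = 0
        · subst hm
          exact augIdeal_zero (c i).2 g
        · exact hc i ⟨m, g⟩ (by rw [hi]; exact hm)
      rw [TensorCoalgebra.word, (PiTensorProduct.tprod A).map_coord_zero i hci, map_zero]
      exact zero_mem _
    · push Not at h0
      have h1 : ∀ i, p i = 1 := by
        have := (Finset.sum_eq_zero_iff_of_nonneg fun i _ => by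
          have := h0 i
          omega).1 hp
        intro i
        have := this i (Finset.mem_univ i)
        omega
      rw [word_eq_listWord]
      refine Submodule.subset_span ⟨_, ?_, rfl⟩
      intro x hx
      obtain ⟨i, rfl⟩ := List.mem_ofFn.1 hx
      rw [← h1 i]
      exact hc i
  · rintro _ ⟨cs, hcs, rfl⟩
    exact listWord_mem_barDegree hcs

theorem ev_eq_zero_of_barDegree {T : Bar A Γ} (hT : T ∈ barDegree (idealDegree A Γ) 0)
    {l : List (Simplex Γ)} {σ : Simplex Γ} (hσ : σ ∈ l) (h1 : σ.1 ≠ 1) :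
    (ev simplexEval l).ofConv T = 0 := by
  suffices barDegree (idealDegree A Γ) 0 ≤ LinearMap.ker (ev simplexEval l).ofConv from this hT
  rw [barDegree_zero_eq_span, Submodule.span_le]
  rintro _ ⟨cs, hcs, rfl⟩
  rw [SetLike.mem_coe, LinearMap.mem_ker]
  induction l generalizing cs with
  | nil => simp at hσ
  | cons τ l ih =>
    rcases cs with _ | ⟨c, cs⟩
    · simp
    · rw [ev_cons_listWord]
      rcases List.mem_cons.1 hσ with rfl | h
      · rw [simplexEval_apply, hcs c (by simp) σ h1, zero_mul]
      · rw [ih h cs fun c hc => hcs c (by simp [hc]), mul_zero]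

/-- For the converse, `T` is compared with its image under the projection of every letter to degree
one. Words of edges do not distinguish the two, and all other words vanish on both. -/
theorem mem_barDegree_iff [IsDomain A] [IsPrincipalIdealRing A] {T : Bar A Γ} :
    T ∈ barDegree (idealDegree A Γ) 0 ↔
      ∀ l : List (Simplex Γ), (∃ σ ∈ l, σ.1 ≠ 1) → (ev simplexEval l).ofConv T = 0 := by
  refine ⟨fun h l ⟨σ, hσ, h1⟩ => ev_eq_zero_of_barDegree h hσ h1, fun h => ?_⟩
  have hmem : ∀ T : Bar A Γ, map (degreeOne A Γ) T ∈ barDegree (idealDegree A Γ) 0 := by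
    intro T
    have hT : T ∈ Submodule.span A (Set.range (listWord : List (augIdeal A Γ) → Bar A Γ)) := by
      rw [span_listWord]; trivial
    suffices Submodule.span A (Set.range listWord) ≤
      (barDegree (idealDegree A Γ) 0).comap (map (degreeOne A Γ)) from this hT
    rw [Submodule.span_le]
    rintro _ ⟨cs, rfl⟩
    rw [SetLike.mem_coe, Submodule.mem_comap, map_listWord]
    refine listWord_mem_barDegree fun c hc => ?_
    obtain ⟨c, -, rfl⟩ := List.mem_map.1 hc
    exact degreeOne_mem c
  suffices T = map (degreeOne A Γ) T by rw [this]; exact hmem T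
  rw [← sub_eq_zero]
  refine separates_ev separates_simplexEval _ fun l => ?_
  beta_reduce
  rw [map_sub]
  by_cases hl : ∃ σ ∈ l, σ.1 ≠ 1
  · rw [h l hl]
    rw [zero_sub, neg_eq_zero]
    exact ev_eq_zero_of_barDegree (hmem T) hl.choose_spec.1 hl.choose_spec.2
  · push Not at hl
    rw [sub_eq_zero, ev_map]
    have : ev simplexEval l = ev (fun σ => simplexEval σ ∘ₗ degreeOne A Γ) l := by
      rw [ev, ev]
      congr 1
      refine List.map_congr_left fun σ hσ => ?_
      congr 1
      refine LinearMap.ext fun f => ?_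
      exact (if_pos (hl σ hσ)).symm
    rw [this]

end Cocycles

/-! ### The cocycle equation and the sub-coalgebra of cocycles -/

section CocycleEquation

open TensorCoalgebra

variable {A : Type*} [CommRing A] {Γ : Type*} [Group Γ]

/-- The shifted degree `|c| - 1` is zero, so all the signs in the Bar differential are trivial on
degree zero elements. -/
theorem idealSign_of_degree_one {c : augIdeal A Γ} (hc : c ∈ idealDegree A Γ 1) :
    idealSign A Γ c = c := by
  refine Subtype.ext (funext fun σ => ?_)
  change (-1) ^ (σ.1 + 1) * (c : Simplex Γ → A) σ = (c : Simplex Γ → A) σ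
  by_cases h : σ.1 = 1
  · rw [h]; norm_num
  · rw [hc σ h, mul_zero]

theorem idealD_of_degree_one {c : augIdeal A Γ} (hc : c ∈ idealDegree A Γ 1) :
    idealD A Γ c ∈ idealDegree A Γ 2 := by
  rintro ⟨_ | n, g⟩ hσ
  · rfl
  · change ∑ i : Fin (n + 2), (-1) ^ (i : ℕ) * (c : Simplex Γ → A) ⟨n, face i g⟩ = 0
    refine Finset.sum_eq_zero fun i _ => ?_
    rw [hc ⟨n, face i g⟩ (fun h : n = 1 => hσ (by simp [h])), mul_zero]

theorem idealCup_of_degree_one {c c' : augIdeal A Γ} (hc : c ∈ idealDegree A Γ 1)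
    (hc' : c' ∈ idealDegree A Γ 1) : idealCup A Γ c c' ∈ idealDegree A Γ 2 := by
  rintro ⟨n, g⟩ hσ
  change ∑ i : Fin (n + 1), (c : Simplex Γ → A) (front i g) * (c' : Simplex Γ → A) (back i g) = 0
  refine Finset.sum_eq_zero fun i _ => ?_
  by_cases hi : (i : ℕ) = 1
  · rw [hc' (back i g) (fun h : n - (i : ℕ) = 1 => hσ (by change n = 2; omega)), mul_zero]
  · rw [hc (front i g) hi, zero_mul]

theorem idealD_triangle (c : augIdeal A Γ) (g h : Γ) :
    (idealD A Γ c : Simplex Γ → A) (triangle g h) =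
      (c : Simplex Γ → A) (edge g) - (c : Simplex Γ → A) (edge (g * h)) +
        (c : Simplex Γ → A) (edge h) := by
  change ∑ i : Fin 3, (-1) ^ (i : ℕ) * (c : Simplex Γ → A) ⟨1, face i ![g, h]⟩ = _
  have h0 : face 0 ![g, h] = fun _ => h := by funext i; rw [Subsingleton.elim i 0]; rfl
  have h1 : face 1 ![g, h] = fun _ => g * h := by funext i; rw [Subsingleton.elim i 0]; rfl
  have h2 : face 2 ![g, h] = fun _ => g := by funext i; rw [Subsingleton.elim i 0]; rfl
  rw [Fin.sum_univ_three, h0, h1, h2]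
  simp [edge]
  ring

theorem idealCup_triangle (c c' : augIdeal A Γ) (g h : Γ) :
    (idealCup A Γ c c' : Simplex Γ → A) (triangle g h) =
      (c : Simplex Γ → A) (edge g) * (c' : Simplex Γ → A) (edge h) := by
  change ∑ i : Fin 3, (c : Simplex Γ → A) (front i ![g, h]) *
    (c' : Simplex Γ → A) (back i ![g, h]) = _
  rw [Fin.sum_univ_three]
  have h0 : (c : Simplex Γ → A) (front 0 ![g, h]) = 0 := augIdeal_zero c.2 _
  have h2 : (c' : Simplex Γ → A) (back 2 ![g, h]) = 0 := augIdeal_zero c'.2 _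
  have h1 : front 1 ![g, h] = edge g := by
    refine congrArg (Sigma.mk 1) (funext fun i : Fin 1 => ?_)
    rw [Subsingleton.elim i 0]
    rfl
  have h1' : back 1 ![g, h] = edge h := by
    refine congrArg (Sigma.mk 1) (funext fun i : Fin 1 => ?_)
    rw [Subsingleton.elim i 0]
    rfl
  rw [h0, h2, h1, h1', zero_mul, mul_zero, zero_add, add_zero]

variable (A) in
/-- Evaluation of words of weight one at an edge, as an element of the convolution algebra. -/
def edgeEval (g : Γ) : WithConv (Bar A Γ →ₗ[A] A) := letterEval (simplexEval (edge g))

variable (A) in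
/-- The deviation of `edgeEval` from being multiplicative. -/
def defect (g h : Γ) : WithConv (Bar A Γ →ₗ[A] A) :=
  edgeEval A (g * h) - edgeEval A g - edgeEval A h - edgeEval A g * edgeEval A h

theorem ev_edge_cons (g : Γ) (l : List (Simplex Γ)) :
    ev simplexEval (edge g :: l) = edgeEval A g * ev simplexEval l := ev_cons _ _ _

theorem edgeEval_mul_nil (g : Γ) (f : WithConv (Bar A Γ →ₗ[A] A)) :
    (edgeEval A g * f).ofConv (listWord []) = 0 :=
  letterEval_mul_nil _ _

theorem edgeEval_mul_cons (g : Γ) (f : WithConv (Bar A Γ →ₗ[A] A)) (c : augIdeal A Γ)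
    (cs : List (augIdeal A Γ)) :
    (edgeEval A g * f).ofConv (listWord (c :: cs)) =
      (c : Simplex Γ → A) (edge g) * f.ofConv (listWord cs) :=
  letterEval_mul_cons _ _ _ _

theorem barD_nil : barD A Γ (listWord []) = 0 := barDifferential_word_zero _ _ _ _

theorem ev_barD_cons {c : augIdeal A Γ} (hc : c ∈ idealDegree A Γ 1) (cs : List (augIdeal A Γ))
    (σ : Simplex Γ) (l : List (Simplex Γ)) :
    (ev simplexEval (σ :: l)).ofConv (barD A Γ (listWord (c :: cs))) =
      -((idealD A Γ c : Simplex Γ → A) σ * (ev simplexEval l).ofConv (listWord cs)) -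
        (ev simplexEval (σ :: l)).ofConv (mapFirst (idealCup A Γ c) (listWord cs)) +
        (c : Simplex Γ → A) σ * (ev simplexEval l).ofConv (barD A Γ (listWord cs)) := by
  rw [← cons_listWord, barD, barDifferential_cons, idealSign_of_degree_one hc, map_add, map_sub,
    map_neg, ev_cons_cons, ev_cons_cons]
  rfl

theorem ev_mapFirst_cup_eq_zero {c : augIdeal A Γ} (hc : c ∈ idealDegree A Γ 1)
    {cs : List (augIdeal A Γ)} (hcs : ∀ c ∈ cs, c ∈ idealDegree A Γ 1) {σ : Simplex Γ}
    (hσ : σ.1 ≠ 2) (l : List (Simplex Γ)) :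
    (ev simplexEval (σ :: l)).ofConv (mapFirst (idealCup A Γ c) (listWord cs)) = 0 := by
  rcases cs with _ | ⟨c', cs⟩
  · rw [mapFirst_nil, map_zero]
  · rw [← cons_listWord, mapFirst_cons, ev_cons_cons, simplexEval_apply,
      idealCup_of_degree_one hc (hcs c' (by simp)) σ hσ, zero_mul]

theorem ev_barD_cons_of_ne_two {c : augIdeal A Γ} (hc : c ∈ idealDegree A Γ 1)
    {cs : List (augIdeal A Γ)} (hcs : ∀ c ∈ cs, c ∈ idealDegree A Γ 1) {σ : Simplex Γ}
    (hσ : σ.1 ≠ 2) (l : List (Simplex Γ)) :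
    (ev simplexEval (σ :: l)).ofConv (barD A Γ (listWord (c :: cs))) =
      (c : Simplex Γ → A) σ * (ev simplexEval l).ofConv (barD A Γ (listWord cs)) := by
  rw [ev_barD_cons hc, ev_mapFirst_cup_eq_zero hc hcs hσ, idealD_of_degree_one hc σ hσ]
  simp

theorem ev_nil_barD (cs : List (augIdeal A Γ)) :
    (ev simplexEval []).ofConv (barD A Γ (listWord cs)) = 0 := by
  rcases cs with _ | ⟨c, cs⟩
  · rw [barD_nil, map_zero]
  · rw [← cons_listWord, barD, barDifferential_cons, map_add, map_sub, map_neg, ev_nil_cons_apply,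
      ev_nil_cons_apply]
    rcases cs with _ | ⟨c', cs⟩
    · rw [mapFirst_nil]; simp
    · rw [← cons_listWord, mapFirst_cons, ev_nil_cons_apply]; simp

/-- Every term of the differential contains a letter of degree two, which vanishes on edges. -/
theorem ev_barD_edges (gs : List Γ) {cs : List (augIdeal A Γ)}
    (hcs : ∀ c ∈ cs, c ∈ idealDegree A Γ 1) :
    (ev simplexEval (gs.map edge)).ofConv (barD A Γ (listWord cs)) = 0 := by
  induction gs generalizing cs with
  | nil => exact ev_nil_barD cs
  | cons g gs ih =>
    rcases cs with _ | ⟨c, cs⟩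
    · rw [barD_nil, map_zero]
    · rw [List.map_cons, ev_barD_cons_of_ne_two (hcs c (by simp))
        (fun c hc => hcs c (by simp [hc])) (by simp [edge]), ih fun c hc => hcs c (by simp [hc]),
        mul_zero]

theorem ev_barD_of_dim_ne (gs : List Γ) {σ : Simplex Γ} (h₁ : σ.1 ≠ 1) (h₂ : σ.1 ≠ 2)
    (l : List (Simplex Γ)) {cs : List (augIdeal A Γ)} (hcs : ∀ c ∈ cs, c ∈ idealDegree A Γ 1) :
    (ev simplexEval (gs.map edge ++ σ :: l)).ofConv (barD A Γ (listWord cs)) = 0 := by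
  induction gs generalizing cs with
  | nil =>
    rcases cs with _ | ⟨c, cs⟩
    · rw [barD_nil, map_zero]
    · rw [List.map_nil, List.nil_append, ev_barD_cons_of_ne_two (hcs c (by simp))
        (fun c hc => hcs c (by simp [hc])) h₂, hcs c (by simp) σ h₁, zero_mul]
  | cons g gs ih =>
    rcases cs with _ | ⟨c, cs⟩
    · rw [barD_nil, map_zero]
    · rw [List.map_cons, List.cons_append, ev_barD_cons_of_ne_two (hcs c (by simp))
        (fun c hc => hcs c (by simp [hc])) (by simp [edge]), ih fun c hc => hcs c (by simp [hc]),
        mul_zero]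

theorem defect_mul_nil (g h : Γ) (f : WithConv (Bar A Γ →ₗ[A] A)) :
    (defect A g h * f).ofConv (listWord []) = 0 := by
  simp only [defect, sub_mul, mul_assoc, WithConv.ofConv_sub, LinearMap.sub_apply,
    edgeEval_mul_nil, sub_zero]

theorem defect_mul_cons (g h : Γ) (f : WithConv (Bar A Γ →ₗ[A] A)) (c : augIdeal A Γ)
    (cs : List (augIdeal A Γ)) :
    (defect A g h * f).ofConv (listWord (c :: cs)) =
      -((idealD A Γ c : Simplex Γ → A) (triangle g h) * f.ofConv (listWord cs)) -
        (c : Simplex Γ → A) (edge g) * (edgeEval A h * f).ofConv (listWord cs) := by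
  simp only [defect, sub_mul, mul_assoc, WithConv.ofConv_sub, LinearMap.sub_apply,
    edgeEval_mul_cons, idealD_triangle]
  ring

/-- On the triangle `(g, h)`, the term `-dc` gives `c(gh) - c(g) - c(h)` and the cup product term
gives `-c(g) c'(h)`. Together they are the linear and the quadratic part of `defect`. -/
theorem ev_barD_triangle (gs : List Γ) (g h : Γ) (l : List (Simplex Γ))
    {cs : List (augIdeal A Γ)} (hcs : ∀ c ∈ cs, c ∈ idealDegree A Γ 1) :
    (ev simplexEval (gs.map edge ++ triangle g h :: l)).ofConv (barD A Γ (listWord cs)) =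
      (ev simplexEval (gs.map edge) * defect A g h * ev simplexEval l).ofConv (listWord cs) := by
  induction gs generalizing cs with
  | nil =>
    rw [List.map_nil, List.nil_append, ev_nil_eq_one, one_mul]
    rcases cs with _ | ⟨c, cs⟩
    · rw [barD_nil, map_zero, defect_mul_nil]
    · rw [ev_barD_cons (hcs c (by simp)), defect_mul_cons,
        hcs c (by simp) (triangle g h) (by simp [triangle]), zero_mul, add_zero]
      congr 1
      rcases cs with _ | ⟨c', cs⟩
      · rw [mapFirst_nil, map_zero, edgeEval_mul_nil, mul_zero]
      · rw [← cons_listWord, mapFirst_cons, ev_cons_cons, cons_listWord, edgeEval_mul_cons,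
          simplexEval_apply, idealCup_triangle, mul_assoc]
  | cons g' gs ih =>
    rw [List.map_cons, List.cons_append, ev_edge_cons g' (gs.map edge), mul_assoc, mul_assoc]
    rcases cs with _ | ⟨c, cs⟩
    · rw [barD_nil, map_zero, edgeEval_mul_nil]
    · rw [ev_barD_cons_of_ne_two (hcs c (by simp)) (fun c hc => hcs c (by simp [hc]))
        (by simp [edge]), ih fun c hc => hcs c (by simp [hc]), edgeEval_mul_cons, mul_assoc]

theorem eqOn_barDegree_zero {W : Type*} [AddCommGroup W] [Module A W] {f g : Bar A Γ →ₗ[A] W}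
    (h : ∀ cs : List (augIdeal A Γ), (∀ c ∈ cs, c ∈ idealDegree A Γ 1) →
      f (listWord cs) = g (listWord cs)) {T : Bar A Γ}
    (hT : T ∈ barDegree (idealDegree A Γ) 0) : f T = g T := by
  rw [barDegree_zero_eq_span] at hT
  refine LinearMap.eqOn_span ?_ hT
  rintro _ ⟨cs, hcs, rfl⟩
  exact h cs hcs

theorem conv_defect_eq (l l' : List (Simplex Γ)) (g h : Γ) :
    ev (A := A) simplexEval l * defect A g h * ev simplexEval l' =
      ev simplexEval (l ++ edge (g * h) :: l') - ev simplexEval (l ++ edge g :: l') -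
        ev simplexEval (l ++ edge h :: l') - ev simplexEval (l ++ edge g :: edge h :: l') := by
  simp only [ev_append, ev_edge_cons, defect, mul_sub, sub_mul, mul_assoc]

theorem conv_defect_eq_zero_of_barDegree {T : Bar A Γ}
    (hT : T ∈ barDegree (idealDegree A Γ) 0) {l l' : List (Simplex Γ)} {σ : Simplex Γ}
    (hσ : σ ∈ l ∨ σ ∈ l') (h1 : σ.1 ≠ 1) (g h : Γ) :
    (ev simplexEval l * defect A g h * ev simplexEval l').ofConv T = 0 := by
  have key : ∀ m, (ev simplexEval (l ++ (m ++ l'))).ofConv T = 0 := fun m =>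
    ev_eq_zero_of_barDegree hT (σ := σ) (by simp only [List.mem_append]; tauto) h1
  rw [conv_defect_eq]
  simp only [WithConv.ofConv_sub, LinearMap.sub_apply]
  have k1 := fun g => key [edge g]
  have k2 := key [edge g, edge h]
  simp only [List.cons_append, List.nil_append] at k1 k2
  simp only [k1, k2, sub_zero]

variable [IsDomain A] [IsPrincipalIdealRing A]

/-- Degree zero cocycles of `Bar(Γ;A)` are the tensors supported on edges that satisfy
`T(…|gh|…) = T(…|g|…) + T(…|h|…) + T(…|g|h|…)`. -/
theorem mem_H0Bar_iff {T : Bar A Γ} : T ∈ H0Bar A Γ ↔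
    (∀ l : List (Simplex Γ), (∃ σ ∈ l, σ.1 ≠ 1) → (ev simplexEval l).ofConv T = 0) ∧
      ∀ (l : List (Simplex Γ)) (g h : Γ) (l' : List (Simplex Γ)),
        (ev simplexEval l * defect A g h * ev simplexEval l').ofConv T = 0 := by
  rw [H0Bar, Submodule.mem_inf, ← mem_barDegree_iff]
  refine and_congr_right fun hdeg => ?_
  rw [LinearMap.mem_ker]
  constructor
  · intro hT l g h l'
    rcases exists_split l with ⟨gs, rfl⟩ | ⟨gs, σ, l₀, hσ, rfl⟩
    · rw [← eqOn_barDegree_zero (f := (ev simplexEval (gs.map edge ++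
        triangle g h :: l')).ofConv ∘ₗ barD A Γ) (fun cs hcs =>
          ev_barD_triangle gs g h l' hcs) hdeg,
        LinearMap.comp_apply, hT, map_zero]
    · exact conv_defect_eq_zero_of_barDegree hdeg (σ := σ) (Or.inl (by simp)) hσ g h
  · intro hT
    -- The vanishing of the differential is tested on all words of simplices. Only those whose first
    -- non-edge is a triangle impose a condition, and that condition is the assumed one.
    refine separates_ev separates_simplexEval _ fun l => ?_
    beta_reduce
    rcases exists_split l with ⟨gs, rfl⟩ | ⟨gs, σ, l', hσ, rfl⟩
    · exact eqOn_barDegree_zero (f := (ev simplexEval (gs.map edge)).ofConv ∘ₗ barD A Γ) (g := 0)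
        (fun cs hcs => ev_barD_edges gs hcs) hdeg
    · by_cases h2 : σ.1 = 2
      · obtain ⟨g, h, rfl⟩ := exists_eq_triangle h2
        rw [← hT (gs.map edge) g h l']
        exact eqOn_barDegree_zero (f := (ev simplexEval (gs.map edge ++
          triangle g h :: l')).ofConv ∘ₗ barD A Γ) (fun cs hcs =>
            ev_barD_triangle gs g h l' hcs) hdeg
      · exact eqOn_barDegree_zero (f := (ev simplexEval (gs.map edge ++ σ :: l')).ofConv ∘ₗ
          barD A Γ) (g := 0) (fun cs hcs => ev_barD_of_dim_ne gs hσ h2 l' hcs) hdeg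

variable (A Γ) in
/-- The functionals that cut out `H⁰_Bar(Γ;A)` in `Bar(Γ;A)`. -/
def cocycleFunctional : {l : List (Simplex Γ) // ∃ σ ∈ l, σ.1 ≠ 1} ⊕
    (List (Simplex Γ) × Γ × Γ × List (Simplex Γ)) → Bar A Γ →ₗ[A] A :=
  Sum.elim (fun l => (ev simplexEval l.1).ofConv) fun p =>
    (ev simplexEval p.1 * defect A p.2.1 p.2.2.1 * ev simplexEval p.2.2.2).ofConv

theorem H0Bar_eq_commonKer : H0Bar A Γ = commonKer (cocycleFunctional A Γ) := by
  ext T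
  rw [mem_H0Bar_iff, mem_commonKer, Sum.forall, Subtype.forall]
  simp only [Prod.forall]
  rfl

-- Multiplying a defining functional on either side by a word of evaluations gives a defining
-- functional again, and such words separate points. So both tensor factors of the coproduct lie in
-- the common kernel.
variable (A Γ) in
theorem isSubcoalgebra_H0Bar : IsSubcoalgebra (H0Bar A Γ) := by
  intro T hT
  have hs := separates_ev (separates_simplexEval (A := A) (Γ := Γ))
  obtain ⟨h₁, h₂⟩ := mem_H0Bar_iff.1 hT
  rw [H0Bar_eq_commonKer]
  refine mem_range_map hs hs ?_ ?_
  · rintro (⟨l, σ, hσ, h⟩ | ⟨l, g, h, l'⟩) m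
    · change (ev (A := A) simplexEval l * ev simplexEval m).ofConv T = 0
      rw [← ev_append]
      exact h₁ _ ⟨σ, by simp [hσ], h⟩
    · change (ev (A := A) simplexEval l * defect A g h * ev simplexEval l' *
        ev simplexEval m).ofConv T = 0
      rw [mul_assoc, ← ev_append]
      exact h₂ _ _ _ _
  · rintro m (⟨l, σ, hσ, h⟩ | ⟨l, g, h, l'⟩)
    · change (ev (A := A) simplexEval m * ev simplexEval l).ofConv T = 0
      rw [← ev_append]
      exact h₁ _ ⟨σ, by simp [hσ], h⟩
    · change (ev (A := A) simplexEval m * (ev simplexEval l * defect A g h *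
        ev simplexEval l')).ofConv T = 0
      rw [← mul_assoc, ← mul_assoc, ← ev_append]
      exact h₂ _ _ _ _

end CocycleEquation

/-! ### Coalgebra structures on sub-coalgebras -/

section Subcoalgebra

variable {A : Type*} [CommRing A] [IsDomain A] [IsPrincipalIdealRing A]
variable {B : Type*} [AddCommGroup B] [Module A B] {H : Submodule A B}

/-- Functionals pulled back along an injection still separate points, hence so do their products on
the tensor product of the sources. -/
theorem injective_map_of_separates {V W V' W' : Type*} [AddCommGroup V] [Module A V]
    [AddCommGroup W] [Module A W] [AddCommGroup V'] [Module A V'] [AddCommGroup W'] [Module A W']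
    {ι κ : Type*} {lam : ι → V →ₗ[A] A} {phi : κ → W →ₗ[A] A} (hl : Separates lam)
    (hp : Separates phi) {f : V' →ₗ[A] V} {g : W' →ₗ[A] W} (hf : Function.Injective f)
    (hg : Function.Injective g) : Function.Injective (TensorProduct.map f g) := by
  rw [injective_iff_map_eq_zero]
  intro z hz
  refine (hl.of_injective hf).tensor (hp.of_injective hg) z fun p => ?_
  rw [← tensorFunctional_map, hz, map_zero]

/-- A sub-coalgebra has exactly one coalgebra structure for which its inclusion is a homomorphism
of coalgebras. -/
theorem existsUnique_coalgebra [Coalgebra A B] {ι : Type*} {lam : ι → B →ₗ[A] A}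
    (hl : Separates lam) (hH : IsSubcoalgebra H) : ∃! c : Coalgebra A H,
      TensorProduct.map H.subtype H.subtype ∘ₗ c.comul = CoalgebraStruct.comul ∘ₗ H.subtype ∧
        c.counit = CoalgebraStruct.counit ∘ₗ H.subtype := by
  -- Injectivity of `H ⊗ H → B ⊗ B` makes the restricted coproduct well defined and unique.
  -- Injectivity of the triple tensor product lets coassociativity be checked in `B`.
  have hi := injective_map_of_separates hl hl H.injective_subtype H.injective_subtype
  have hi3 := injective_map_of_separates hl (hl.tensor hl) H.injective_subtype hi
  let E := LinearEquiv.ofInjective _ hi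
  let δ : H →ₗ[A] H ⊗[A] H := E.symm.toLinearMap ∘ₗ
    (CoalgebraStruct.comul ∘ₗ H.subtype).codRestrict _ fun x => hH x.1 x.2
  have hδ : TensorProduct.map H.subtype H.subtype ∘ₗ δ = CoalgebraStruct.comul ∘ₗ H.subtype := by
    refine LinearMap.ext fun x => ?_
    exact congrArg Subtype.val (E.apply_symm_apply _)
  let ε : H →ₗ[A] A := CoalgebraStruct.counit ∘ₗ H.subtype
  refine ⟨@Coalgebra.mk A H _ _ _ ⟨δ, ε⟩ ?_ ?_ ?_, ⟨hδ, rfl⟩, ?_⟩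
  · refine LinearMap.ext fun x => hi3 ?_
    have h1 : TensorProduct.map H.subtype (TensorProduct.map H.subtype H.subtype) ∘ₗ
        (TensorProduct.assoc A H H H).toLinearMap ∘ₗ δ.rTensor H =
        (TensorProduct.assoc A B B B).toLinearMap ∘ₗ
          (CoalgebraStruct.comul (R := A) (A := B)).rTensor B ∘ₗ
            TensorProduct.map H.subtype H.subtype := by
      have : TensorProduct.map H.subtype (TensorProduct.map H.subtype H.subtype) ∘ₗ
          (TensorProduct.assoc A H H H).toLinearMap = (TensorProduct.assoc A B B B).toLinearMap ∘ₗ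
          TensorProduct.map (TensorProduct.map H.subtype H.subtype) H.subtype := by
        ext; rfl
      rw [← LinearMap.comp_assoc, this, LinearMap.comp_assoc]
      congr 1
      rw [LinearMap.rTensor, LinearMap.rTensor, ← TensorProduct.map_comp, ← TensorProduct.map_comp,
        hδ]
      rfl
    have h2 : TensorProduct.map H.subtype (TensorProduct.map H.subtype H.subtype) ∘ₗ
        δ.lTensor H = (CoalgebraStruct.comul (R := A) (A := B)).lTensor B ∘ₗ
          TensorProduct.map H.subtype H.subtype := by
      rw [LinearMap.lTensor, LinearMap.lTensor, ← TensorProduct.map_comp, ← TensorProduct.map_comp,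
        hδ]
      rfl
    have h3 := LinearMap.congr_fun h1 (δ x)
    have h4 := LinearMap.congr_fun h2 (δ x)
    have h5 := LinearMap.congr_fun hδ x
    have h6 := LinearMap.congr_fun (Coalgebra.coassoc (R := A) (A := B)) x.1
    simp only [LinearMap.comp_apply] at h3 h4 h5 h6 ⊢
    rw [h3, h4, h5]
    exact h6
  · refine LinearMap.ext fun x => ?_
    have hi1 : Function.Injective (LinearMap.lTensor A H.subtype) := by
      have h := (TensorProduct.lid A B).symm.injective.comp
        (H.injective_subtype.comp (TensorProduct.lid A H).injective)
      convert h using 1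
      funext z
      refine LinearMap.congr_fun (f := LinearMap.lTensor A H.subtype) (g :=
        (TensorProduct.lid A B).symm.toLinearMap ∘ₗ H.subtype ∘ₗ
          (TensorProduct.lid A H).toLinearMap) ?_ z
      ext
      simp
    refine hi1 ?_
    have h1 : LinearMap.lTensor A H.subtype ∘ₗ ε.rTensor H =
        (CoalgebraStruct.counit (R := A) (A := B)).rTensor B ∘ₗ
          TensorProduct.map H.subtype H.subtype := by
      ext; rfl
    have h2 := LinearMap.congr_fun h1 (δ x)
    have h5 := LinearMap.congr_fun hδ x
    have h6 := LinearMap.congr_fun (Coalgebra.rTensor_counit_comp_comul (R := A) (A := B)) x.1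
    simp only [LinearMap.comp_apply] at h2 h5 h6 ⊢
    rw [h2, h5]
    exact h6
  · refine LinearMap.ext fun x => ?_
    have hi1 : Function.Injective (LinearMap.rTensor A H.subtype) := by
      have h := (TensorProduct.rid A B).symm.injective.comp
        (H.injective_subtype.comp (TensorProduct.rid A H).injective)
      convert h using 1
      funext z
      refine LinearMap.congr_fun (f := LinearMap.rTensor A H.subtype) (g :=
        (TensorProduct.rid A B).symm.toLinearMap ∘ₗ H.subtype ∘ₗ
          (TensorProduct.rid A H).toLinearMap) ?_ z
      ext
      simp
    refine hi1 ?_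
    have h1 : LinearMap.rTensor A H.subtype ∘ₗ ε.lTensor H =
        (CoalgebraStruct.counit (R := A) (A := B)).lTensor B ∘ₗ
          TensorProduct.map H.subtype H.subtype := by
      ext; rfl
    have h2 := LinearMap.congr_fun h1 (δ x)
    have h5 := LinearMap.congr_fun hδ x
    have h6 := LinearMap.congr_fun (Coalgebra.lTensor_counit_comp_comul (R := A) (A := B)) x.1
    simp only [LinearMap.comp_apply] at h2 h5 h6 ⊢
    rw [h2, h5]
    exact h6
  · intro c hc
    obtain @⟨⟨δ', ε'⟩, hc₁, hc₂, hc₃⟩ := c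
    obtain ⟨h, h'⟩ := hc
    have hδ' : δ' = δ := LinearMap.ext fun x => hi <|
      (LinearMap.congr_fun h x).trans (LinearMap.congr_fun hδ x).symm
    have hε' : ε' = ε := h'
    subst hδ' hε'
    rfl

end Subcoalgebra

open TensorCoalgebra

/-! ### The Magnus expansion and the cocycles built from it -/

section Magnus

variable {A : Type*} [CommRing A] {V : Type*} [AddCommGroup V] [Module A V]

/-- The functional `c₁|⋯|cₙ ↦ (-1)ⁿ f(c₁) ⋯ f(cₙ)`. -/
def signedProduct (f : V →ₗ[A] A) : WithConv (TensorCoalgebra A V →ₗ[A] A) :=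
  WithConv.toConv (desc fun n => (-1 : A) ^ n • PiTensorProduct.lift
    ((MultilinearMap.mkPiAlgebra A (Fin n) A).compLinearMap fun _ => f))

theorem signedProduct_nil (f : V →ₗ[A] A) : (signedProduct f).ofConv (listWord []) = 1 := by
  simp [signedProduct, listWord, desc_word]

theorem signedProduct_cons (f : V →ₗ[A] A) (c : V) (l : List V) :
    (signedProduct f).ofConv (listWord (c :: l)) =
      -(f c * (signedProduct f).ofConv (listWord l)) := by
  simp only [signedProduct, listWord, desc_word, LinearMap.smul_apply, PiTensorProduct.lift.tprod,
    MultilinearMap.compLinearMap_apply, MultilinearMap.mkPiAlgebra_apply]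
  have h : ∏ i : Fin (c :: l).length, f ((c :: l).get i) = f c * ∏ i, f (l.get i) :=
    Fin.prod_univ_succ (n := l.length) fun i => f ((c :: l).get i)
  rw [h, List.length_cons, pow_succ]
  simp only [smul_eq_mul]
  ring

theorem conv_ext {f g : WithConv (TensorCoalgebra A V →ₗ[A] A)}
    (h : ∀ l, f.ofConv (listWord l) = g.ofConv (listWord l)) : f = g :=
  WithConv.ofConv_injective (listHom_ext h)

theorem conv_one_apply (T : TensorCoalgebra A V) :
    (1 : WithConv (TensorCoalgebra A V →ₗ[A] A)).ofConv T = CoalgebraStruct.counit (R := A) T := rfl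

theorem conv_nil (f g : WithConv (TensorCoalgebra A V →ₗ[A] A)) :
    (f * g).ofConv (listWord []) = f.ofConv (listWord []) * g.ofConv (listWord []) := by
  rw [conv_apply, comul_listWord]
  simp

/-- `signedProduct f` is the geometric series of `-letterEval f`, so the product telescopes. -/
theorem one_add_letterEval_mul_signedProduct (f : V →ₗ[A] A) :
    (1 + letterEval f) * signedProduct f = 1 := by
  refine conv_ext fun l => ?_
  rw [add_mul, one_mul, WithConv.ofConv_add, LinearMap.add_apply, conv_one_apply, counit_listWord]
  rcases l with _ | ⟨c, l⟩
  · rw [letterEval_mul_nil, signedProduct_nil]; simp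
  · rw [letterEval_mul_cons, signedProduct_cons]; simp

/-- On a word `c :: l`, the functional `letterEval f * g` only involves the value of `g` on `l`, so
`g` vanishes by induction on the length. This cancellation turns the right inverse of `1 +
letterEval f` into a two-sided one. -/
theorem eq_zero_of_one_add_letterEval_mul (f : V →ₗ[A] A)
    {g : WithConv (TensorCoalgebra A V →ₗ[A] A)} (h : (1 + letterEval f) * g = 0) : g = 0 := by
  refine conv_ext fun l => ?_
  have hl : ∀ l, g.ofConv (listWord l) + (letterEval f * g).ofConv (listWord l) = 0 := fun l => by
    rw [← LinearMap.add_apply, ← WithConv.ofConv_add, ← one_add_mul, h]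
    rfl
  change _ = (0 : A)
  induction l with
  | nil =>
    have h0 := hl []
    rwa [letterEval_mul_nil, add_zero] at h0
  | cons c l ih =>
    have h0 := hl (c :: l)
    rwa [letterEval_mul_cons, ih, mul_zero, add_zero] at h0

/-- The invertible functional `1 + letterEval f`. -/
def magnusUnit (f : V →ₗ[A] A) : (WithConv (TensorCoalgebra A V →ₗ[A] A))ˣ where
  val := 1 + letterEval f
  inv := signedProduct f
  val_inv := one_add_letterEval_mul_signedProduct f
  inv_val := by
    rw [← sub_eq_zero]
    refine eq_zero_of_one_add_letterEval_mul f ?_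
    rw [mul_sub, ← mul_assoc, one_add_letterEval_mul_signedProduct, one_mul, mul_one, sub_self]

variable (A) {S : Type*}

/-- The Magnus expansion, as a homomorphism to the units of the dual algebra of `T(A^S)`. -/
def magnus : FreeGroup S →* (WithConv (TensorCoalgebra A (S → A) →ₗ[A] A))ˣ :=
  FreeGroup.lift fun s => magnusUnit (LinearMap.proj s)

/-- The reduced Magnus expansion. -/
def magnusReduced (w : FreeGroup S) : WithConv (TensorCoalgebra A (S → A) →ₗ[A] A) :=
  (magnus A w : WithConv (TensorCoalgebra A (S → A) →ₗ[A] A)) - 1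

theorem magnusReduced_of (s : S) :
    magnusReduced A (FreeGroup.of s) = letterEval (LinearMap.proj s) := by
  rw [magnusReduced, magnus, FreeGroup.lift_apply_of]
  exact add_sub_cancel_left _ _

theorem magnusReduced_one : magnusReduced A (1 : FreeGroup S) = 0 := by
  rw [magnusReduced, map_one, Units.val_one, sub_self]

theorem magnusReduced_mul (g h : FreeGroup S) : magnusReduced A (g * h) =
    magnusReduced A g + magnusReduced A h + magnusReduced A g * magnusReduced A h := by
  simp only [magnusReduced, map_mul, Units.val_mul, mul_sub, sub_mul, one_mul, mul_one]
  abel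

theorem magnus_nil (w : FreeGroup S) :
    (magnus A w : WithConv (TensorCoalgebra A (S → A) →ₗ[A] A)).ofConv (listWord []) = 1 := by
  induction w using FreeGroup.induction_on with
  | C1 => rw [map_one, Units.val_one, conv_one_apply, counit_listWord]; simp
  | of s =>
    rw [magnus, FreeGroup.lift_apply_of]
    change (1 + letterEval _ : WithConv (TensorCoalgebra A (S → A) →ₗ[A] A)).ofConv _ = 1
    rw [WithConv.ofConv_add, LinearMap.add_apply, conv_one_apply, counit_listWord,
      letterEval_apply, letter_nil]
    simp
  | inv_of s _ =>
    rw [map_inv, magnus, FreeGroup.lift_apply_of]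
    exact signedProduct_nil _
  | mul g h hg hh => rw [map_mul, Units.val_mul, conv_nil, hg, hh, one_mul]

/-- The reduced expansion has no constant term. This is what restricts the block decompositions of a
word below to nonempty blocks. -/
theorem magnusReduced_nil (w : FreeGroup S) :
    (magnusReduced A w).ofConv (listWord []) = 0 := by
  rw [magnusReduced, WithConv.ofConv_sub, LinearMap.sub_apply, magnus_nil, conv_one_apply,
    counit_listWord]
  simp

variable {A}

/-- The cochain of degree one on `BF_S` given by a coefficient of the Magnus expansion. -/
def magnusCochain (T : TensorCoalgebra A (S → A)) : augIdeal A (FreeGroup S) where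
  val σ := match σ with
    | ⟨1, g⟩ => (magnusReduced A (g 0)).ofConv T
    | _ => 0
  property := by
    refine ⟨⟨?_, 1, ?_⟩, rfl⟩
    · rintro (_ | _ | n) g ⟨i, hi⟩
      · rfl
      · change (magnusReduced A (g 0)).ofConv T = 0
        rw [show g 0 = 1 by rw [← hi, show i = 0 from Fin.ext (by omega)], magnusReduced_one]
        rfl
      · rfl
    · rintro (_ | _ | n) g hn
      · rfl
      · simp at hn
      · rfl

theorem magnusCochain_mem (T : TensorCoalgebra A (S → A)) :
    magnusCochain T ∈ idealDegree A (FreeGroup S) 1 := by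
  rintro ⟨_ | _ | n, g⟩ h
  · rfl
  · simp at h
  · rfl

theorem cons_mem_barDegree {Γ : Type*} [Group Γ] {c : augIdeal A Γ} (hc : c ∈ idealDegree A Γ 1)
    {T : Bar A Γ} (hT : T ∈ barDegree (idealDegree A Γ) 0) :
    cons c T ∈ barDegree (idealDegree A Γ) 0 := by
  suffices barDegree (idealDegree A Γ) 0 ≤ (barDegree (idealDegree A Γ) 0).comap (cons c) from
    this hT
  conv_lhs => rw [barDegree_zero_eq_span]
  rw [Submodule.span_le]
  rintro _ ⟨cs, hcs, rfl⟩
  rw [SetLike.mem_coe, Submodule.mem_comap, cons_listWord]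
  exact listWord_mem_barDegree (List.forall_mem_cons.2 ⟨hc, hcs⟩)

/-- The lift is the sum over all ways of cutting `cs` into nonempty consecutive blocks, each block
replaced by its `magnusCochain`; it is built recursively, first block first. Evaluation on edges
reproduces the iterated coproduct of `cs` that computes the convolution product. -/
theorem exists_magnus_lift (cs : List (S → A)) : ∃ T ∈ barDegree (idealDegree A (FreeGroup S)) 0,
    ∀ gs : List (FreeGroup S), (ev simplexEval (gs.map edge)).ofConv T =
      (gs.map (magnusReduced A)).prod.ofConv (listWord cs) := by
  induction hn : cs.length using Nat.strong_induction_on generalizing cs with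
  | _ n ih =>
    subst hn
    by_cases h0 : cs = []
    · subst h0
      refine ⟨listWord [], listWord_mem_barDegree (by simp), fun gs => ?_⟩
      rcases gs with _ | ⟨g, gs⟩
      · rw [List.map_nil, ev_nil, List.map_nil, List.prod_nil, conv_one_apply, counit_listWord,
          counit_listWord]
        rfl
      · rw [List.map_cons, ev_cons_nil, List.map_cons, List.prod_cons, conv_nil, magnusReduced_nil,
          zero_mul]
    -- The lifts are extended by the default value zero to lists that are not shorter, so that a
    -- choice function is defined on all lists.
    · have ih' : ∀ cs' : List (S → A), ∃ T : Bar A (FreeGroup S), cs'.length < cs.length →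
          T ∈ barDegree (idealDegree A (FreeGroup S)) 0 ∧
          ∀ gs : List (FreeGroup S), (ev simplexEval (gs.map edge)).ofConv T =
            (gs.map (magnusReduced A)).prod.ofConv (listWord cs') := by
        intro cs'
        by_cases h : cs'.length < cs.length
        · obtain ⟨T, hT⟩ := ih _ h cs' rfl
          exact ⟨T, fun _ => hT⟩
        · exact ⟨0, fun h' => absurd h' h⟩
      choose τ hτ using ih'
      have hlen : 0 < cs.length := List.length_pos_iff.2 h0
      have hlt : ∀ i, (cs.drop (i + 1)).length < cs.length := fun i => by
        rw [List.length_drop]; omega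
      refine ⟨∑ i ∈ Finset.range cs.length,
        cons (magnusCochain (listWord (cs.take (i + 1)))) (τ (cs.drop (i + 1))), ?_, ?_⟩
      · exact sum_mem fun i _ => cons_mem_barDegree (magnusCochain_mem _) (hτ _ (hlt i)).1
      · intro gs
        rw [map_sum]
        rcases gs with _ | ⟨g, gs⟩
        · rw [List.map_nil, List.map_nil, List.prod_nil, conv_one_apply, counit_listWord,
            if_neg hlen.ne']
          exact Finset.sum_eq_zero fun i _ => ev_nil_cons_apply _ _ _
        -- The cut before the first letter contributes nothing because the reduced expansion
        -- vanishes on the empty word; the remaining cuts match the summands of the lift.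
        · rw [List.map_cons, List.map_cons, List.prod_cons, conv_apply, comul_listWord, map_sum,
            Finset.sum_range_succ', List.take_zero, tensorFunctional_tmul, magnusReduced_nil,
            zero_mul, add_zero]
          refine Finset.sum_congr rfl fun i _ => ?_
          rw [ev_cons_cons, (hτ _ (hlt i)).2, tensorFunctional_tmul]
          rfl

end Magnus

/-! ### Bar cohomology of the free group -/

section FreeComparison

variable {A : Type*} [CommRing A] {S : Type*}

/-- Normalization: the edge of the identity is degenerate. -/
theorem edgeEval_one {Γ : Type*} [Group Γ] : edgeEval A (1 : Γ) = 0 := by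
  have : (simplexEval (edge (1 : Γ)) : augIdeal A Γ →ₗ[A] A) = 0 :=
    LinearMap.ext fun f => f.2.1.1 1 _ ⟨0, rfl⟩
  rw [edgeEval, letterEval, this]
  rfl

theorem separates_proj : Separates fun s : S => (LinearMap.proj s : (S → A) →ₗ[A] A) :=
  fun _ hv => funext hv

theorem ev_proj_map_restrictToLetters (ss : List S) (T : Bar A (FreeGroup S)) :
    (ev (fun s : S => (LinearMap.proj s : (S → A) →ₗ[A] A)) ss).ofConv
      (map (restrictToLetters A S) T) =
      (ev simplexEval ((ss.map FreeGroup.of).map edge)).ofConv T := by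
  rw [ev_map, List.map_map, ← ev_comp]
  rfl

variable [IsDomain A] [IsPrincipalIdealRing A]

theorem ev_edge_mul {Γ : Type*} [Group Γ] {T : Bar A Γ} (hT : T ∈ H0Bar A Γ)
    (l l' : List (Simplex Γ)) (g h : Γ) :
    (ev simplexEval (l ++ edge (g * h) :: l')).ofConv T =
      (ev simplexEval (l ++ edge g :: l')).ofConv T +
        (ev simplexEval (l ++ edge h :: l')).ofConv T +
          (ev simplexEval (l ++ edge g :: edge h :: l')).ofConv T := by
  have := (mem_H0Bar_iff.1 hT).2 l g h l'
  rw [conv_defect_eq] at this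
  simp only [WithConv.ofConv_sub, LinearMap.sub_apply] at this
  linear_combination this

/-- Downward induction on the length of the words: once `T` vanishes on all longer words of edges,
the quadratic term of the cocycle equation drops out. Evaluation is then additive in each entry, so
it is determined by the entries that are generators. -/
theorem eq_zero_of_ev_letters {T : Bar A (FreeGroup S)} (hT : T ∈ H0Bar A (FreeGroup S))
    (h : ∀ ss : List S, (ev simplexEval ((ss.map FreeGroup.of).map edge)).ofConv T = 0) :
    T = 0 := by
  obtain ⟨N, hN⟩ := exists_mem_weightLE T
  -- Words longer than the weight bound `N` give zero; `k` measures how far below this range a word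
  -- may lie.
  have key : ∀ k, ∀ gs : List (FreeGroup S), N < gs.length + k →
      (ev simplexEval (gs.map edge)).ofConv T = 0 := by
    intro k
    induction k with
    | zero =>
      intro gs hgs
      exact ev_eq_zero_of_mem_weightLE _ hN (by simpa using hgs)
    | succ k ih =>
      -- The entries are reduced to generators from left to right: `ss` are those already treated,
      -- `gs` those that remain.
      have inner : ∀ (gs : List (FreeGroup S)) (ss : List S),
          N < ss.length + gs.length + (k + 1) →
          (ev simplexEval ((ss.map FreeGroup.of).map edge ++ gs.map edge)).ofConv T = 0 := by
        intro gs
        induction gs with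
        | nil =>
          intro ss _
          rw [List.map_nil, List.append_nil]
          exact h ss
        | cons g gs ihgs =>
          intro ss hlen
          rw [List.map_cons]
          have hmul : ∀ g g', (ev simplexEval ((ss.map FreeGroup.of).map edge ++
              edge (g * g') :: gs.map edge)).ofConv T =
              (ev simplexEval ((ss.map FreeGroup.of).map edge ++ edge g :: gs.map edge)).ofConv T +
              (ev simplexEval ((ss.map FreeGroup.of).map edge ++
                edge g' :: gs.map edge)).ofConv T := by
            intro g g'
            rw [ev_edge_mul hT]
            have := ih (ss.map FreeGroup.of ++ g :: g' :: gs) (by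
              simp only [List.length_append, List.length_map, List.length_cons] at hlen ⊢
              omega)
            simp only [List.map_append, List.map_cons] at this
            rw [this, add_zero]
          have hone : (ev simplexEval ((ss.map FreeGroup.of).map edge ++
              edge (1 : FreeGroup S) :: gs.map edge)).ofConv T = 0 := by
            rw [ev_append, ev_edge_cons, edgeEval_one, zero_mul, mul_zero]
            rfl
          have hof : ∀ s, (ev simplexEval ((ss.map FreeGroup.of).map edge ++
              edge (FreeGroup.of s) :: gs.map edge)).ofConv T = 0 := by
            intro s
            have := ihgs (ss ++ [s]) (by simp at hlen ⊢; omega)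
            simpa using this
          induction g using FreeGroup.induction_on with
          | C1 => exact hone
          | of s => exact hof s
          | inv_of s _ =>
            have := hmul (FreeGroup.of s) (FreeGroup.of s)⁻¹
            rw [mul_inv_cancel, hone, hof, zero_add] at this
            exact this.symm
          | mul g g' hg hg' =>
            rw [hmul, hg (by simpa using hlen), hg' (by simpa using hlen), add_zero]
      intro gs hgs
      simpa using inner gs [] (by simpa using hgs)
  refine separates_ev separates_simplexEval T fun l => ?_
  beta_reduce
  by_cases hl : ∃ σ ∈ l, σ.1 ≠ 1
  · exact (mem_H0Bar_iff.1 hT).1 l hl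
  · push Not at hl
    obtain ⟨gs, rfl⟩ := exists_eq_map_edge hl
    exact key (N + 1) gs (by omega)

theorem mem_H0Bar_of_edges {Γ : Type*} [Group Γ] {T : Bar A Γ}
    (hT : T ∈ barDegree (idealDegree A Γ) 0)
    (h : ∀ (gs : List Γ) (g g' : Γ) (gs' : List Γ),
      (ev simplexEval (gs.map edge) * defect A g g' * ev simplexEval (gs'.map edge)).ofConv T = 0) :
    T ∈ H0Bar A Γ := by
  refine mem_H0Bar_iff.2 ⟨mem_barDegree_iff.1 hT, fun l g g' l' => ?_⟩
  by_cases hl : ∃ σ, (σ ∈ l ∨ σ ∈ l') ∧ σ.1 ≠ 1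
  · obtain ⟨σ, hσ, h1⟩ := hl
    exact conv_defect_eq_zero_of_barDegree hT hσ h1 g g'
  · push Not at hl
    obtain ⟨gs, rfl⟩ := exists_eq_map_edge fun σ hσ => hl σ (Or.inl hσ)
    obtain ⟨gs', rfl⟩ := exists_eq_map_edge fun σ hσ => hl σ (Or.inr hσ)
    exact h gs g g' gs'

variable (A S) in
theorem freeComparison_injective : Function.Injective (freeComparison A S) := by
  rw [injective_iff_map_eq_zero]
  intro T hT
  refine Subtype.ext (eq_zero_of_ev_letters T.2 fun ss => ?_)
  rw [← ev_proj_map_restrictToLetters]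
  exact (congrArg _ hT).trans (map_zero _)

-- The Magnus lift of a word is a cocycle because `magnusReduced` satisfies `M(gh) = M(g) + M(h) +
-- M(g) * M(h)`. It restricts to the given word because `magnusReduced` of a generator is the
-- coordinate functional of that letter.
variable (A S) in
theorem freeComparison_surjective : Function.Surjective (freeComparison A S) := by
  rw [← LinearMap.range_eq_top, ← top_le_iff, ← span_listWord, Submodule.span_le]
  rintro _ ⟨cs, rfl⟩
  obtain ⟨T, hdeg, hT⟩ := exists_magnus_lift cs
  have hmem : T ∈ H0Bar A (FreeGroup S) := by
    refine mem_H0Bar_of_edges hdeg fun gs g h gs' => ?_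
    rw [conv_defect_eq]
    have e1 : ∀ g, gs.map edge ++ edge g :: gs'.map edge = (gs ++ g :: gs').map edge := by simp
    have e2 : gs.map edge ++ edge g :: edge h :: gs'.map edge =
        (gs ++ g :: h :: gs').map edge := by simp
    simp only [e1, e2, WithConv.ofConv_sub, LinearMap.sub_apply, hT]
    simp only [← LinearMap.sub_apply, ← WithConv.ofConv_sub, List.map_append, List.prod_append,
      List.map_cons, List.prod_cons, ← mul_sub, magnusReduced_mul]
    have : (magnusReduced A g + magnusReduced A h + magnusReduced A g * magnusReduced A h) *
        (gs'.map (magnusReduced A)).prod - magnusReduced A g * (gs'.map (magnusReduced A)).prod -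
        magnusReduced A h * (gs'.map (magnusReduced A)).prod -
        magnusReduced A g * (magnusReduced A h * (gs'.map (magnusReduced A)).prod) = 0 := by
      simp only [add_mul, mul_assoc]
      abel
    rw [this, mul_zero]
    rfl
  refine ⟨⟨T, hmem⟩, ?_⟩
  change map (restrictToLetters A S) T = listWord cs
  rw [← sub_eq_zero]
  refine separates_ev separates_proj _ fun ss => ?_
  beta_reduce
  rw [map_sub, ev_proj_map_restrictToLetters, hT, sub_eq_zero, List.map_map, ev]
  simp only [Function.comp_def, magnusReduced_of]

end FreeComparison

/-! ### Functoriality of the tensor coalgebra -/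

section CoalgebraMap

variable {A : Type*} [CommRing A] {V W : Type*} [AddCommGroup V] [Module A V] [AddCommGroup W]
  [Module A W]

theorem comul_map (f : V →ₗ[A] W) (T : TensorCoalgebra A V) :
    CoalgebraStruct.comul (R := A) (map f T) =
      TensorProduct.map (map f) (map f) (CoalgebraStruct.comul (R := A) T) := by
  suffices CoalgebraStruct.comul (R := A) ∘ₗ map f =
      TensorProduct.map (map f) (map f) ∘ₗ CoalgebraStruct.comul (R := A) from
    LinearMap.congr_fun this T
  refine listHom_ext fun l => ?_
  simp only [LinearMap.comp_apply, map_listWord, comul_listWord, map_sum, TensorProduct.map_tmul,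
    List.length_map, List.map_take, List.map_drop]

theorem counit_map (f : V →ₗ[A] W) (T : TensorCoalgebra A V) :
    CoalgebraStruct.counit (R := A) (map f T) = CoalgebraStruct.counit (R := A) T := by
  suffices CoalgebraStruct.counit (R := A) ∘ₗ map f = CoalgebraStruct.counit (R := A) from
    LinearMap.congr_fun this T
  refine listHom_ext fun l => ?_
  simp only [LinearMap.comp_apply, map_listWord, counit_listWord, List.length_map]

theorem map_map {U : Type*} [AddCommGroup U] [Module A U] (g : W →ₗ[A] U) (f : V →ₗ[A] W)
    (T : TensorCoalgebra A V) : map g (map f T) = map (g ∘ₗ f) T := by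
  suffices map g ∘ₗ map f = map (g ∘ₗ f) from LinearMap.congr_fun this T
  refine listHom_ext fun l => ?_
  simp [map_listWord]

end CoalgebraMap

/-! ### Letter-braiding numbers as evaluations on edges -/

section LetterBraidingNumber

variable {A : Type*} [CommRing A] {Γ : Type*} [Group Γ]

theorem coeff_one_circleToPolynomial (T : TensorCoalgebra A A) :
    (circleToPolynomial T).coeff 1 = letter T := by
  suffices Polynomial.lcoeff A 1 ∘ₗ circleToPolynomial = letter from LinearMap.congr_fun this T
  refine listHom_ext fun l => ?_
  rw [LinearMap.comp_apply, circleToPolynomial, listWord, desc_word, LinearMap.comp_apply,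
    PiTensorProduct.lift.tprod, Polynomial.lcoeff_apply, Polynomial.coeff_monomial]
  change _ = letter (listWord l)
  split_ifs with h
  · obtain ⟨a, rfl⟩ := List.length_eq_one_iff.1 h
    rw [letter_singleton]
    simp
  · rw [letter_of_length_ne h]

/-- The linear coefficient only sees the weight one part of `T`, so the letter-braiding number is a
single functional in the convolution algebra. -/
theorem letterBraidingNumber_eq (T : H0Bar A Γ) (w : Γ) :
    letterBraidingNumber T w = (edgeEval A w).ofConv (T : Bar A Γ) := by
  rw [letterBraidingNumber, letterBraidingPolynomial, coeff_one_circleToPolynomial, letter_map]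
  rfl

end LetterBraidingNumber

/-! ### Pullback along a surjective homomorphism -/

section Pullback

variable {A : Type*} [CommRing A] {Γ Γ' : Type*} [Group Γ] [Group Γ'] (p : Γ' →* Γ)

/-- The image of a simplex under the simplicial map `BΓ' → BΓ`. -/
def imageSimplex (σ : Simplex Γ') : Simplex Γ := ⟨σ.1, fun i => p (σ.2 i)⟩

theorem ev_barPullback (l : List (Simplex Γ')) (T : Bar A Γ) :
    (ev simplexEval l).ofConv (barPullback A p T) =
      (ev simplexEval (l.map (imageSimplex p))).ofConv T := by
  rw [barPullback, ev_map, ← ev_comp]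
  rfl

variable (A) in
/-- The differences of the evaluations at two simplices with the same image. -/
def fiberDifference
    (q : {q : Simplex Γ' × Simplex Γ' // imageSimplex p q.1 = imageSimplex p q.2}) :
    augIdeal A Γ' →ₗ[A] A :=
  simplexEval q.1.1 - simplexEval q.1.2

variable {p}

theorem imageSimplex_surjective (hp : Function.Surjective p) :
    Function.Surjective (imageSimplex p) := by
  rintro ⟨n, g⟩
  refine ⟨⟨n, fun i => Function.surjInv hp (g i)⟩, ?_⟩
  simp only [imageSimplex, Function.surjInv_eq hp]

/-- A cochain that is constant on the fibres of `imageSimplex p` descends, by evaluating it on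
arbitrary lifts of the coordinates. -/
theorem commonKer_le_range_pullbackIdeal (hp : Function.Surjective p) :
    commonKer (fiberDifference A p) ≤ LinearMap.range (pullbackIdeal A p) := by
  intro f hf
  rw [mem_commonKer] at hf
  have hf' : ∀ σ τ, imageSimplex p σ = imageSimplex p τ →
      (f : Simplex Γ' → A) σ = (f : Simplex Γ' → A) τ :=
    fun σ τ h => sub_eq_zero.1 (hf ⟨(σ, τ), h⟩)
  have hs := Function.surjInv_eq hp
  refine ⟨⟨fun σ => (f : Simplex Γ' → A) ⟨σ.1, fun i => Function.surjInv hp (σ.2 i)⟩,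
    ⟨⟨fun n g hg => ?_, ?_⟩, ?_⟩⟩, ?_⟩
  · obtain ⟨i, hi⟩ := hg
    beta_reduce
    -- The chosen lift of `1` need not be `1`. Constancy on fibres allows replacing it by `1`, which
    -- gives a degenerate simplex.
    rw [hf' ⟨n, fun i => Function.surjInv hp (g i)⟩
      ⟨n, Function.update (fun i => Function.surjInv hp (g i)) i 1⟩ ?_]
    · exact f.2.1.1 n _ ⟨i, Function.update_self _ _ _⟩
    · refine congrArg (Sigma.mk n) (funext fun j => ?_)
      by_cases hj : j = i
      · subst hj
        simp [hs, hi]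
      · simp [hj]
  · exact f.2.1.2.imp fun N hN n g hn => hN n _ hn
  · exact augIdeal_zero f.2 _
  · refine Subtype.ext (funext fun σ => hf' _ _ ?_)
    exact congrArg (Sigma.mk σ.1) (funext fun j => hs _)

variable [IsDomain A] [IsPrincipalIdealRing A]

/-- Every word of simplices of the target lifts to the source, so the pullback of `T` already knows
all the evaluations of `T`. -/
theorem barPullback_injective (hp : Function.Surjective p) :
    Function.Injective (barPullback A p) := by
  rw [injective_iff_map_eq_zero]
  intro T hT
  refine separates_ev separates_simplexEval T fun l => ?_
  obtain ⟨l', rfl⟩ := (List.map_surjective_iff.2 (imageSimplex_surjective hp)) l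
  beta_reduce
  rw [← ev_barPullback, hT, map_zero]

/-- The degree is detected by evaluations, which lift, and the differential commutes with the
injective pullback. -/
theorem mem_H0Bar_of_barPullback (hp : Function.Surjective p) {T : Bar A Γ}
    (hT : barPullback A p T ∈ H0Bar A Γ') :
    T ∈ H0Bar A Γ := by
  refine ⟨mem_barDegree_iff.2 ?_, ?_⟩
  · rintro l ⟨σ, hσ, h1⟩
    obtain ⟨l', rfl⟩ := (List.map_surjective_iff.2 (imageSimplex_surjective hp)) l
    obtain ⟨τ, hτ, rfl⟩ := List.mem_map.1 hσ
    rw [← ev_barPullback]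
    exact mem_barDegree_iff.1 hT.1 l' ⟨τ, hτ, h1⟩
  · refine barPullback_injective hp ?_
    rw [barPullback_barD, map_zero]
    exact hT.2

theorem pullback_injective (hp : Function.Surjective p) :
    Function.Injective (H0Bar.pullback A p) := fun _ _ h =>
  Subtype.ext (barPullback_injective hp (congrArg Subtype.val h))

end Pullback

/-! ### The annihilator of a sub-coalgebra is a two-sided ideal -/

section VanishesOn

variable {A : Type*} [CommRing A] {S : Type*}
variable {H : Submodule A (TensorCoalgebra A (S → A))}

/-- The functionals that vanish on `H`. -/
def VanishesOn (H : Submodule A (TensorCoalgebra A (S → A)))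
    (f : WithConv (TensorCoalgebra A (S → A) →ₗ[A] A)) : Prop := ∀ T ∈ H, f.ofConv T = 0

theorem VanishesOn.add {f g : WithConv (TensorCoalgebra A (S → A) →ₗ[A] A)}
    (hf : VanishesOn H f) (hg : VanishesOn H g) : VanishesOn H (f + g) := fun T hT => by
  rw [WithConv.ofConv_add, LinearMap.add_apply, hf T hT, hg T hT, add_zero]

/-- The coproduct of an element of `H` comes from `H ⊗ H`, and `f` kills the second factor. -/
theorem VanishesOn.mul_left (hH : IsSubcoalgebra H)
    {f : WithConv (TensorCoalgebra A (S → A) →ₗ[A] A)} (hf : VanishesOn H f)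
    (g : WithConv (TensorCoalgebra A (S → A) →ₗ[A] A)) : VanishesOn H (g * f) := by
  intro T hT
  obtain ⟨z, hz⟩ := hH T hT
  have : f.ofConv ∘ₗ H.subtype = 0 := LinearMap.ext fun x => hf x.1 x.2
  rw [conv_apply, ← hz, tensorFunctional_map, this, tensorFunctional, TensorProduct.map_zero_right]
  simp

theorem VanishesOn.mul_right (hH : IsSubcoalgebra H)
    {f : WithConv (TensorCoalgebra A (S → A) →ₗ[A] A)} (hf : VanishesOn H f)
    (g : WithConv (TensorCoalgebra A (S → A) →ₗ[A] A)) : VanishesOn H (f * g) := by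
  intro T hT
  obtain ⟨z, hz⟩ := hH T hT
  have : f.ofConv ∘ₗ H.subtype = 0 := LinearMap.ext fun x => hf x.1 x.2
  rw [conv_apply, ← hz, tensorFunctional_map, this, tensorFunctional, TensorProduct.map_zero_left]
  simp

end VanishesOn

/-! ### Descent of cocycles from the free group to the presented group -/

section Descent

variable {A : Type*} [CommRing A] [IsDomain A] [IsPrincipalIdealRing A] {S : Type*}

variable (A S) in
/-- The comparison isomorphism `H⁰_Bar(F_S;A) ≅ T(A^S)`. -/
def comparisonEquiv : H0Bar A (FreeGroup S) ≃ₗ[A] TensorCoalgebra A (S → A) :=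
  LinearEquiv.ofBijective (freeComparison A S)
    ⟨freeComparison_injective A S, freeComparison_surjective A S⟩

/-- The functional on `T(A^S) ≅ H⁰_Bar(F_S;A)` induced by a functional on the Bar construction. -/
def transport (f : WithConv (Bar A (FreeGroup S) →ₗ[A] A)) :
    WithConv (TensorCoalgebra A (S → A) →ₗ[A] A) :=
  WithConv.toConv (f.ofConv ∘ₗ (H0Bar A (FreeGroup S)).subtype ∘ₗ
    (comparisonEquiv A S).symm.toLinearMap)

theorem transport_comparison (f : WithConv (Bar A (FreeGroup S) →ₗ[A] A))
    (x : H0Bar A (FreeGroup S)) :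
    (transport f).ofConv (freeComparison A S x) = f.ofConv (x : Bar A (FreeGroup S)) := by
  have h : (comparisonEquiv A S).symm (freeComparison A S x) = x :=
    (comparisonEquiv A S).symm_apply_apply x
  simp only [transport, LinearMap.comp_apply, LinearEquiv.coe_coe, h]
  rfl

theorem transport_ext {f : WithConv (Bar A (FreeGroup S) →ₗ[A] A)}
    {g : WithConv (TensorCoalgebra A (S → A) →ₗ[A] A)}
    (h : ∀ x : H0Bar A (FreeGroup S),
      f.ofConv (x : Bar A (FreeGroup S)) = g.ofConv (freeComparison A S x)) :
    transport f = g := by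
  refine WithConv.ofConv_injective (LinearMap.ext fun T => ?_)
  obtain ⟨x, rfl⟩ := freeComparison_surjective A S T
  rw [transport_comparison, h]

theorem transport_sub (f g : WithConv (Bar A (FreeGroup S) →ₗ[A] A)) :
    transport (f - g) = transport f - transport g := rfl

/-- The cocycles form a sub-coalgebra and the comparison map respects coproducts, so restricting
functionals to cocycles and moving them to `T(A^S)` respects convolution. -/
theorem transport_mul (f g : WithConv (Bar A (FreeGroup S) →ₗ[A] A)) :
    transport (f * g) = transport f * transport g := by
  refine transport_ext fun x => ?_
  obtain ⟨z, hz⟩ := isSubcoalgebra_H0Bar A (FreeGroup S) x.1 x.2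
  rw [conv_apply, conv_apply]
  have h : CoalgebraStruct.comul (R := A) (freeComparison A S x) =
      TensorProduct.map (freeComparison A S) (freeComparison A S) z := by
    rw [freeComparison, LinearMap.comp_apply, comul_map]
    change TensorProduct.map _ _ (CoalgebraStruct.comul (R := A) x.1) = _
    rw [← hz, TensorProduct.map_comp]
    rfl
  rw [h, ← hz, tensorFunctional_map, tensorFunctional_map]
  have k : ∀ f : WithConv (Bar A (FreeGroup S) →ₗ[A] A),
      (transport f).ofConv ∘ₗ freeComparison A S =
        f.ofConv ∘ₗ (H0Bar A (FreeGroup S)).subtype :=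
    fun f => LinearMap.ext fun x => transport_comparison f x
  rw [k, k]

/-- This is the cocycle equation. After transport it holds as an identity in the dual algebra: `g ↦
1 + transport (edgeEval A g)` is multiplicative. -/
theorem transport_edgeEval_mul (g h : FreeGroup S) : transport (edgeEval A (g * h)) =
    transport (edgeEval A g) + transport (edgeEval A h) +
      transport (edgeEval A g) * transport (edgeEval A h) := by
  rw [← transport_mul]
  refine transport_ext fun x => ?_
  have hx := (mem_H0Bar_iff.1 x.2).2 [] g h []
  rw [ev_nil_eq_one, one_mul, mul_one, defect] at hx
  simp only [WithConv.ofConv_sub, LinearMap.sub_apply] at hx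
  simp only [WithConv.ofConv_add, LinearMap.add_apply, transport_comparison]
  linear_combination hx

variable {H : Submodule A (TensorCoalgebra A (S → A))}

theorem transport_edgeEval_one : transport (edgeEval A (1 : FreeGroup S)) = 0 := by
  rw [edgeEval_one]
  rfl

/-- If the letter-braiding numbers of a sub-coalgebra vanish on `R`, then they vanish on the normal
closure of `R`. -/
theorem vanishesOn_normalClosure (hH : IsSubcoalgebra H) {R : Set (FreeGroup S)}
    (hR : ∀ r ∈ R, VanishesOn H (transport (edgeEval A r))) {n : FreeGroup S}
    (hn : n ∈ Subgroup.normalClosure R) : VanishesOn H (transport (edgeEval A n)) := by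
  let K : Subgroup (FreeGroup S) :=
    { carrier := {n | VanishesOn H (transport (edgeEval A n))}
      one_mem' := fun T _ => by rw [transport_edgeEval_one]; rfl
      mul_mem' := fun {a b} ha hb => by
        rw [Set.mem_ofPred_eq, transport_edgeEval_mul]
        exact (VanishesOn.add ha hb).add (VanishesOn.mul_left hH hb _)
      inv_mem' := fun {a} ha => by
        have h := transport_edgeEval_mul (A := A) a⁻¹ a
        rw [inv_mul_cancel, transport_edgeEval_one] at h
        -- The equation for `a⁻¹ * a = 1`, solved for the linear term in `a⁻¹`.
        have h' : transport (edgeEval A a⁻¹) =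
            (0 - 1 - transport (edgeEval A a⁻¹)) * transport (edgeEval A a) := by
          rw [sub_mul, sub_mul, zero_mul, one_mul, ← sub_eq_zero]
          refine Eq.trans ?_ h.symm
          abel
        rw [Set.mem_ofPred_eq, h']
        exact VanishesOn.mul_left hH ha _ }
  have hK : K.Normal := ⟨fun n hn g => by
    change VanishesOn H (transport (edgeEval A (g * n * g⁻¹)))
    have h := transport_edgeEval_mul (A := A) g g⁻¹
    rw [mul_inv_cancel, transport_edgeEval_one] at h
    -- Conjugation of `n` becomes multiplication by the units `1 + E(g)` and `1 + E(g⁻¹)`, which a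
    -- two-sided ideal absorbs.
    have h' : transport (edgeEval A (g * n * g⁻¹)) =
        (1 + transport (edgeEval A g)) *
          (transport (edgeEval A n) * (1 + transport (edgeEval A g⁻¹))) := by
      rw [transport_edgeEval_mul, transport_edgeEval_mul]
      rw [← sub_eq_zero]
      calc _ = transport (edgeEval A g) + transport (edgeEval A g⁻¹) +
            transport (edgeEval A g) * transport (edgeEval A g⁻¹) := by
              simp only [mul_add, add_mul, mul_one, one_mul, mul_assoc]
              abel
        _ = 0 := h.symm
    rw [h']
    exact VanishesOn.mul_left hH (VanishesOn.mul_right hH hn _) _⟩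
  exact Subgroup.normalClosure_le_normal (N := K) (fun r hr => hR r hr) hn

/-- Writing `w = w' * n` with `n` in the normal closure gives `E(w) - E(w') = (1 + E(w')) * E(n)`.
-/
theorem vanishesOn_sub (hH : IsSubcoalgebra H) {R : Set (FreeGroup S)}
    (hR : ∀ r ∈ R, VanishesOn H (transport (edgeEval A r))) {w w' : FreeGroup S}
    (h : PresentedGroup.mk R w = PresentedGroup.mk R w') :
    VanishesOn H (transport (edgeEval A w) - transport (edgeEval A w')) := by
  have hn : w'⁻¹ * w ∈ Subgroup.normalClosure R := QuotientGroup.eq.1 h.symm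
  have h1 := transport_edgeEval_mul (A := A) w' (w'⁻¹ * w)
  rw [mul_inv_cancel_left] at h1
  have h2 : transport (edgeEval A w) - transport (edgeEval A w') =
      (1 + transport (edgeEval A w')) * transport (edgeEval A (w'⁻¹ * w)) := by
    rw [h1, add_mul, one_mul]
    abel
  rw [h2]
  exact VanishesOn.mul_left hH (vanishesOn_normalClosure hH hR hn) _

/-- The cocycle corresponding to `T` takes equal values on words of simplices that differ in one
entry by simplices with the same image. By `mem_range_map_of_conv` it is pulled back from the Bar
construction of the quotient, and its preimage is itself a cocycle. -/
theorem mem_range_presentationPullback (hH : IsSubcoalgebra H) {R : Set (FreeGroup S)}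
    (hR : ∀ r ∈ R, VanishesOn H (transport (edgeEval A r)))
    {T : TensorCoalgebra A (S → A)} (hT : T ∈ H) :
    T ∈ LinearMap.range (presentationPullback A R) := by
  have hp : Function.Surjective (PresentedGroup.mk R) := PresentedGroup.mk_surjective R
  obtain ⟨x, rfl⟩ := freeComparison_surjective A S T
  have hx : (x : Bar A (FreeGroup S)) ∈ LinearMap.range (barPullback A (PresentedGroup.mk R)) := by
    rw [barPullback]
    refine mem_range_map_of_conv (e := simplexEval)
      (lam := fiberDifference A (PresentedGroup.mk R)) separates_simplexEval
      (commonKer_le_range_pullbackIdeal hp) ?_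
    rintro l ⟨⟨σ, τ⟩, hστ⟩ l'
    by_cases hσ : σ.1 = 1
    · have hτ : τ.1 = 1 := (congrArg Sigma.fst hστ).symm.trans hσ
      obtain ⟨g, rfl⟩ := exists_eq_edge hσ
      obtain ⟨g', rfl⟩ := exists_eq_edge hτ
      have hgg' : PresentedGroup.mk R g = PresentedGroup.mk R g' := by
        have := eq_of_heq (Sigma.mk.inj_iff.1 hστ).2
        exact congrFun this (0 : Fin 1)
      have h1 : (letterEval (simplexEval (edge g) - simplexEval (edge g')) :
          WithConv (Bar A (FreeGroup S) →ₗ[A] A)) = edgeEval A g - edgeEval A g' := rfl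
      change (ev (A := A) simplexEval l *
        letterEval (simplexEval (edge g) - simplexEval (edge g')) * ev simplexEval l').ofConv
          (x : Bar A (FreeGroup S)) = 0
      rw [h1, ← transport_comparison, transport_mul, transport_mul, transport_sub]
      exact VanishesOn.mul_right hH (VanishesOn.mul_left hH (vanishesOn_sub hH hR hgg') _) _ _ hT
    -- Away from edges both evaluations vanish for degree reasons.
    · have hτ : τ.1 ≠ 1 := fun h => hσ ((congrArg Sigma.fst hστ).trans h)
      have h1 : ev (A := A) simplexEval l * letterEval (simplexEval σ - simplexEval τ) *
          ev simplexEval l' = ev simplexEval (l ++ σ :: l') - ev simplexEval (l ++ τ :: l') := by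
        rw [ev_append, ev_append, ev_cons, ev_cons, ← mul_sub, ← sub_mul, ← mul_assoc]
        rfl
      change (ev (A := A) simplexEval l * letterEval (simplexEval σ - simplexEval τ) *
        ev simplexEval l').ofConv (x : Bar A (FreeGroup S)) = 0
      rw [h1, WithConv.ofConv_sub, LinearMap.sub_apply,
        ev_eq_zero_of_barDegree x.2.1 (σ := σ) (by simp) hσ,
        ev_eq_zero_of_barDegree x.2.1 (σ := τ) (by simp) hτ, sub_zero]
  obtain ⟨y, hy⟩ := hx
  refine ⟨⟨y, mem_H0Bar_of_barPullback hp (by rw [hy]; exact x.2)⟩, ?_⟩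
  rw [presentationPullback, LinearMap.comp_apply]
  congr 1
  exact Subtype.ext hy

theorem freeLetterBraidingNumber_eq (T : TensorCoalgebra A (S → A)) (w : FreeGroup S) :
    freeLetterBraidingNumber T w = (transport (edgeEval A w)).ofConv T := by
  obtain ⟨x, rfl⟩ := freeComparison_surjective A S T
  -- Injectivity of the comparison map makes `Function.invFun` return `x` itself.
  rw [freeLetterBraidingNumber, Function.leftInverse_invFun (freeComparison_injective A S) x,
    letterBraidingNumber_eq, transport_comparison]

end Descent

/-! ### The image of the pullback -/

section Presentation

variable {A : Type*} [CommRing A] {S : Type*} (R : Set (FreeGroup S))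

theorem presentationPullback_apply (x : H0Bar A (PresentedGroup R)) :
    presentationPullback A R x =
      map (restrictToLetters A S ∘ₗ pullbackIdeal A (PresentedGroup.mk R)) x.1 :=
  map_map _ _ _

/-- In this form the pullback is the restriction of a map `T(f)`, which is visibly compatible with
coproduct and counit. -/
theorem presentationPullback_eq : presentationPullback A R =
    map (restrictToLetters A S ∘ₗ pullbackIdeal A (PresentedGroup.mk R)) ∘ₗ
      (H0Bar A (PresentedGroup R)).subtype :=
  LinearMap.ext fun x => presentationPullback_apply R x

variable [IsDomain A] [IsPrincipalIdealRing A]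

theorem isSubcoalgebra_range_presentationPullback :
    IsSubcoalgebra (LinearMap.range (presentationPullback A R)) := by
  rintro _ ⟨x, rfl⟩
  obtain ⟨z, hz⟩ := isSubcoalgebra_H0Bar A (PresentedGroup R) x.1 x.2
  refine ⟨TensorProduct.map (presentationPullback A R).rangeRestrict
    (presentationPullback A R).rangeRestrict z, ?_⟩
  rw [presentationPullback_apply, comul_map, ← hz, ← LinearMap.comp_apply, ← LinearMap.comp_apply,
    ← TensorProduct.map_comp, ← TensorProduct.map_comp, ← presentationPullback_eq]
  rfl

/-- A relation maps to the identity, so its edge becomes degenerate and normalized cochains vanish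
on it. -/
theorem transport_edgeEval_presentationPullback {r : FreeGroup S} (hr : r ∈ R)
    (x : H0Bar A (PresentedGroup R)) :
    (transport (edgeEval A r)).ofConv (presentationPullback A R x) = 0 := by
  rw [presentationPullback, LinearMap.comp_apply, transport_comparison]
  have h1 : PresentedGroup.mk R r = 1 := PresentedGroup.one_of_mem hr
  have h2 : (simplexEval (edge r) ∘ₗ pullbackIdeal A (PresentedGroup.mk R)) = 0 :=
    LinearMap.ext fun f => f.2.1.1 1 _ ⟨0, h1⟩
  change simplexEval (edge r) (letter (map (pullbackIdeal A (PresentedGroup.mk R)) x.1)) = 0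
  rw [letter_map, ← LinearMap.comp_apply, h2, LinearMap.zero_apply]

end Presentation

end LetterBraiding

end

theorem corollary5p9 {A : Type*} [CommRing A] [IsDomain A] [IsPrincipalIdealRing A]
    {S : Type*} (R : Set (FreeGroup S)) :
    -- the identification of the Bar cohomology of the free group with the tensor coalgebra
    Function.Bijective (LetterBraiding.freeComparison A S) ∧
    -- the Bar cohomology of the presented group is a coalgebra in exactly one compatible way
    (∃! c : Coalgebra A (LetterBraiding.H0Bar A (PresentedGroup R)),
      LetterBraiding.IsBarCoalgebra A (PresentedGroup R) c) ∧
    -- the pullback along the quotient map is an injective homomorphism of coalgebras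
    Function.Injective (LetterBraiding.presentationPullback A R) ∧
    (∀ c : Coalgebra A (LetterBraiding.H0Bar A (PresentedGroup R)),
      LetterBraiding.IsBarCoalgebra A (PresentedGroup R) c →
        TensorProduct.map (LetterBraiding.presentationPullback A R)
            (LetterBraiding.presentationPullback A R) ∘ₗ c.comul =
          CoalgebraStruct.comul ∘ₗ LetterBraiding.presentationPullback A R ∧
        CoalgebraStruct.counit ∘ₗ LetterBraiding.presentationPullback A R = c.counit) ∧
    -- its image is the maximal sub-coalgebra with vanishing letter-braiding numbers on relations
    IsGreatest
      {H : Submodule A (LetterBraiding.TensorCoalgebra A (S → A)) |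
        LetterBraiding.IsSubcoalgebra H ∧
          ∀ T ∈ H, ∀ r ∈ R, LetterBraiding.freeLetterBraidingNumber T r = 0}
      (LinearMap.range (LetterBraiding.presentationPullback A R)) := by
  open LetterBraiding in
  refine ⟨⟨freeComparison_injective A S, freeComparison_surjective A S⟩,
    existsUnique_coalgebra (TensorCoalgebra.separates_ev separates_simplexEval)
      (isSubcoalgebra_H0Bar A _), ?_, ?_, ⟨?_, ?_⟩, ?_⟩
  · exact (freeComparison_injective A S).comp (pullback_injective (PresentedGroup.mk_surjective R))
  · rintro c ⟨hcomul, hcounit⟩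
    constructor
    · rw [presentationPullback_eq, TensorProduct.map_comp, LinearMap.comp_assoc, hcomul]
      exact LinearMap.ext fun x => (comul_map _ _).symm
    · rw [hcounit, presentationPullback_eq]
      exact LinearMap.ext fun x => counit_map _ _
  · exact isSubcoalgebra_range_presentationPullback R
  · rintro _ ⟨x, rfl⟩ r hr
    rw [freeLetterBraidingNumber_eq]
    exact transport_edgeEval_presentationPullback R hr x
  · rintro H ⟨hH, hR⟩ T hT
    exact mem_range_presentationPullback hH
      (fun r hr T hT => by rw [← freeLetterBraidingNumber_eq]; exact hR T hT r hr) hT
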